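/- Let $n,r\ge 0$, let $B:\mathbb{R}^{2n}\times\mathbb{R}^{2n}\to\mathbb{R}^r$ be a skew-symmetric bilinear map, and let $\mathcal N=\mathbb{R}^{2n}\times\mathbb{R}^r$ carry the group law $(x,t)\cdot(y,s)=(x+y,\,t+s+2B(x,y))$, so that $(x,t)^{-1}=(-x,-t)$. For $\tau\in\mathbb{R}^r$ put $B^\tau(x,y)=\sum_{\beta}\tau_\beta B^\beta(x,y)$, and assume that $B^\tau$ is non-degenerate for almost every $\tau\in\mathbb{R}^r$. *Frames.* Let $\tau\mapsto(v_1^\tau,\dots,v_{2n}^\tau)$ be any (almost everywhere) measurable choice of orthonormal bases of $\mathbb{R}^{2n}$ that depends only on the direction $\dot\tau=\tau/|\tau|$ and normalizes $B^\tau$ for almost every $\tau$; that is, with $y=\sum_k y_k^\tau v_k^\tau$ and $\mu_j(\tau)=-B^\tau(v_{2j-1}^\tau,v_{2j}^\tau)$ one has $\mu_j(\tau)\ge 0$ and $$B^\tau(x,y)=\sum_{j=1}^n\mu_j(\tau)\left(-x_{2j-1}^\tau y_{2j}^\tau+x_{2j}^\tau y_{2j-1}^\tau\right).$$ (Such choices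 exist.) *Laguerre distributions.* Let $L_k^{(p)}$ be the generalized Laguerre polynomials and $l_k^{(p)}(\sigma)=\left[\frac{\Gamma(k+1)}{\Gamma(k+p+1)}\right]^{1/2}L_k^{(p)}(\sigma)\,\sigma^{p/2}e^{-\sigma/2}$ for $\sigma\ge 0$, $k,p\in\mathbb{Z}_{\ge0}$. For $k\in\mathbb{Z}_{\ge 0}$, $p\in\mathbb{Z}$ and $y=(y_1,y_2)\in\mathbb{R}^2$ with $y_1+iy_2=|y|e^{i\theta}$ set $$\widetilde{\mathscr L}_k^{(p)}(y,\tau)=\frac{2|\tau|}{\pi}(\operatorname{sgn}p)^p\,l_k^{(|p|)}(2|\tau||y|^2)\,e^{ip\theta}$$ (with $0^0=1$), and for $\mathbf k\in\mathbb{Z}_{\ge0}^n$, $\mathbf p\in\mathbb{Z}^n$ let $$\widetilde{\mathscr L}_{\mathbf k}^{(\mathbf p)}(y,\tau)=\prod_{j=1}^n\mu_j(\dot\tau)\,\widetilde{\mathscr L}_{k_j}^{(p_j)}\left(\sqrt{\mu_j(\dot\tau)}\,(y_{2j-1}^\tau,y_{2j}^\tau),\tau\right),\qquad (y,\tau)\in\mathbb{R}^{2n}\times\mathbb{R}^r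 .$$ Let $\mathscr L_{\mathbf k}^{(\mathbf p)}\in\mathcal S'(\mathbb{R}^{2n+r})$ be the tempered distribution with partial Fourier transform $\widetilde{\mathscr L}_{\mathbf k}^{(\mathbf p)}$, i.e. $$\langle\mathscr L_{\mathbf k}^{(\mathbf p)},\varphi\rangle=\int_{\mathbb{R}^{2n}\times\mathbb{R}^r}\widetilde{\mathscr L}_{\mathbf k}^{(\mathbf p)}(y,\tau)\left(\frac1{(2\pi)^r}\int_{\mathbb{R}^r}e^{i\tau\cdot s}\varphi(y,s)\,ds\right)dy\,d\tau,\qquad\varphi\in\mathcal S(\mathbb{R}^{2n+r}).$$ For $f\in\mathcal S(\mathbb{R}^{2n+r})$ and $w\in\mathcal N$ put $(f*\mathscr L_{\mathbf k}^{(\mathbf p)})(w)=\langle\mathscr L_{\mathbf k}^{(\mathbf p)},\,v\mapsto f(w\cdot v^{-1})\rangle$. *Claim.* 1. For all $\mathbf k\in\mathbb{Z}_{\ge0}^n$ and $\mathbf p\in\mathbb{Z}^n$, the map $f\mapsto f*\mathscr L_{\mathbf k}^{(\mathbf p)}$, $f\in\mathcal S(\mathbb{R}^{2n+r})$, takes values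 in $L^2(\mathbb{R}^{2n+r})$ and extends (uniquely) to a bounded linear operator of $L^2(\mathbb{R}^{2n+r})$. This extension defines $f*\mathscr L_{\mathbf k}^{(\mathbf p)}\in L^2(\mathbb{R}^{2n+r})$ for $f\in L^2(\mathbb{R}^{2n+r})$. 2. For every $f\in\mathcal S(\mathbb{R}^{2n+r})$ and every point $w\in\mathcal N$, the series $\sum_{\mathbf k\in\mathbb{Z}_{\ge0}^n}(f*\mathscr L_{\mathbf k}^{(\mathbf 0)})(w)\,R^{|\mathbf k|}$, $|\mathbf k|=k_1+\dots+k_n$, converges absolutely for $0\le R<1$, and its sum tends to $f(w)$ as $R\to1^-$. -/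

import Mathlib

open MeasureTheory Filter Topology
open scoped SchwartzMap FourierTransform ContDiff

namespace StepTwo
set_option linter.unusedSectionVars false

noncomputable section

section PartialFourier

variable {E W : Type*} [NormedAddCommGroup E] [NormedSpace ℝ E]
  [NormedAddCommGroup W] [InnerProductSpace ℝ W] [FiniteDimensional ℝ W]
  [MeasurableSpace W] [BorelSpace W]

/-- The inverse partial Fourier transform in the second variable. -/
def invPartialFourier (φ : E × W → ℂ) (z : E × W) : ℂ :=
  ((2 * Real.pi) ^ Module.finrank ℝ W : ℝ)⁻¹ *
    ∫ s : W, Complex.exp (Complex.I * (inner ℝ z.2 s : ℝ)) * φ (z.1, s)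

/-- The restriction of a Schwartz function to a slice `{y} × W`. -/
def slice (φ : 𝓢(E × W, ℂ)) (y : E) : 𝓢(W, ℂ) :=
  SchwartzMap.compCLMOfAntilipschitz (K := 1) (g := fun s : W => ((y, s) : E × W)) ℂ
    (by
      have h : (fun s : W => ((y, s) : E × W)) =
          fun s => (y, (0 : W)) + ContinuousLinearMap.inr ℝ E W s := by
        ext s <;> simp
      rw [h]; fun_prop)
    (fun a b => by simp [Prod.edist_eq]) φ

@[simp] lemma slice_apply (φ : 𝓢(E × W, ℂ)) (y : E) (s : W) : slice φ y s = φ (y, s) := rfl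

lemma norm_iteratedFDeriv_slice_le (φ : 𝓢(E × W, ℂ)) (y : E) (p : ℕ) (s : W) :
    ‖iteratedFDeriv ℝ p (slice φ y) s‖ ≤ ‖iteratedFDeriv ℝ p φ (y, s)‖ := by
  have h : (slice φ y : W → ℂ) =
      (fun x => φ (x + (y, 0))) ∘ (ContinuousLinearMap.inr ℝ E W) := by
    ext t; simp
  rw [h]
  rw [ContinuousLinearMap.iteratedFDeriv_comp_right (n := ∞) _ ?_ _ (by exact_mod_cast le_top)]
  · refine (ContinuousMultilinearMap.norm_compContinuousLinearMap_le _ _).trans ?_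
    rw [iteratedFDeriv_comp_add_right]
    have : ((ContinuousLinearMap.inr ℝ E W) s + (y, 0)) = (y, s) := by ext <;> simp
    rw [this]
    refine mul_le_of_le_one_right (norm_nonneg _) ?_
    refine Finset.prod_le_one (fun _ _ => norm_nonneg _) (fun _ _ => ?_)
    refine ContinuousLinearMap.opNorm_le_bound _ zero_le_one (fun x => by simp [Prod.norm_def])
  · exact (φ.smooth ⊤).comp (contDiff_id.add contDiff_const)

lemma invPartialFourier_eq (φ : 𝓢(E × W, ℂ)) (z : E × W) :
    invPartialFourier φ z = ((2 * Real.pi) ^ Module.finrank ℝ W : ℝ)⁻¹ *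
      𝓕 (slice φ z.1 : W → ℂ) (-(2 * Real.pi)⁻¹ • z.2) := by
  unfold invPartialFourier
  rw [Real.fourier_eq']
  congr 1
  refine integral_congr_ae (Eventually.of_forall fun s => ?_)
  simp only [smul_eq_mul, slice_apply]
  congr 2
  rw [inner_smul_right, real_inner_comm]
  push_cast
  have : (Real.pi : ℂ) ≠ 0 := by exact_mod_cast Real.pi_ne_zero
  field_simp

lemma integrable_invPartialFourier (φ : 𝓢(E × W, ℂ)) (z : E × W) :
    Integrable fun s : W => Complex.exp (Complex.I * (inner ℝ z.2 s : ℝ)) * φ (z.1, s) := by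
  refine ((slice φ z.1).integrable (μ := volume)).norm.mono' ?_ (Eventually.of_forall fun s => ?_)
  · have := (slice φ z.1).continuous
    simp only [← slice_apply]
    exact Continuous.aestronglyMeasurable (by fun_prop)
  · rw [norm_mul, mul_comm Complex.I, Complex.norm_exp_ofReal_mul_I, one_mul, slice_apply]

lemma invPartialFourier_add (φ ψ : 𝓢(E × W, ℂ)) (z : E × W) :
    invPartialFourier (φ + ψ : 𝓢(E × W, ℂ)) z =
      invPartialFourier φ z + invPartialFourier ψ z := by
  unfold invPartialFourier
  rw [← mul_add, ← integral_add (integrable_invPartialFourier φ z)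
    (integrable_invPartialFourier ψ z)]
  simp only [_root_.add_apply, mul_add]

lemma invPartialFourier_smul (c : ℂ) (φ : 𝓢(E × W, ℂ)) (z : E × W) :
    invPartialFourier (c • φ : 𝓢(E × W, ℂ)) z = c * invPartialFourier φ z := by
  unfold invPartialFourier
  rw [mul_left_comm c]
  congr 1
  rw [← integral_const_mul]
  refine integral_congr_ae (Eventually.of_forall fun s => ?_)
  simp only [_root_.smul_apply, smul_eq_mul]
  ring

lemma exists_integral_slice_le (a p : ℕ) : ∃ (C : ℝ) (t : Finset (ℕ × ℕ)), 0 ≤ C ∧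
    ∀ (φ : 𝓢(E × W, ℂ)) (y : E),
      (1 + ‖y‖) ^ a * ∫ s, ‖iteratedFDeriv ℝ p (slice φ y) s‖ ≤
        C * t.sup (schwartzSeminormFamily ℂ (E × W) ℂ) φ := by
  set d := (volume : Measure W).integrablePower with hd
  have hint : Integrable (fun s : W => (1 + ‖s‖) ^ (-(d : ℝ))) :=
    Measure.integrable_pow_neg_integrablePower _
  refine ⟨2 ^ (a + d) * ∫ s : W, (1 + ‖s‖) ^ (-(d : ℝ)), Finset.Iic (a + d, p),
    mul_nonneg (by positivity) (integral_nonneg fun s => by positivity), fun φ y => ?_⟩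
  set S := (Finset.Iic (a + d, p)).sup (schwartzSeminormFamily ℂ (E × W) ℂ) φ with hS
  rw [← integral_const_mul]
  have hle : ∀ s, (1 + ‖y‖) ^ a * ‖iteratedFDeriv ℝ p (slice φ y) s‖ ≤
      2 ^ (a + d) * S * (1 + ‖s‖) ^ (-(d : ℝ)) := by
    intro s
    have h1 := SchwartzMap.one_add_le_sup_seminorm_apply (𝕜 := ℂ) (m := (a + d, p)) (k := a + d)
      (n := p) le_rfl le_rfl φ (y, s)
    have hy : ‖y‖ ≤ ‖(y, s)‖ := norm_fst_le (y, s)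
    have hs : ‖s‖ ≤ ‖(y, s)‖ := norm_snd_le (y, s)
    have h2 : (1 + ‖y‖) ^ a * (1 + ‖s‖) ^ d * ‖iteratedFDeriv ℝ p (slice φ y) s‖ ≤
        2 ^ (a + d) * S := by
      refine le_trans ?_ h1
      rw [pow_add]
      gcongr
      exact norm_iteratedFDeriv_slice_le φ y p s
    rw [Real.rpow_neg (by positivity), Real.rpow_natCast, ← div_eq_mul_inv,
      le_div_iff₀ (by positivity)]
    linarith
  calc ∫ s, (1 + ‖y‖) ^ a * ‖iteratedFDeriv ℝ p (slice φ y) s‖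
      ≤ ∫ s : W, 2 ^ (a + d) * S * (1 + ‖s‖) ^ (-(d : ℝ)) :=
        integral_mono_of_nonneg (Eventually.of_forall fun s => by positivity)
          (hint.const_mul _) (Eventually.of_forall hle)
    _ = _ := by rw [integral_const_mul]; ring

lemma exists_invPartialFourier_le (a b : ℕ) : ∃ (C : ℝ) (t : Finset (ℕ × ℕ)), 0 ≤ C ∧
    ∀ (φ : 𝓢(E × W, ℂ)) (z : E × W),
      (1 + ‖z.1‖) ^ a * ‖z.2‖ ^ b * ‖invPartialFourier φ z‖ ≤
        C * t.sup (schwartzSeminormFamily ℂ (E × W) ℂ) φ := by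
  choose C t hC h using exists_integral_slice_le (E := E) (W := W) a
  set c : ℝ := ((2 * Real.pi) ^ Module.finrank ℝ W : ℝ)⁻¹ * (2 * Real.pi) ^ b * 2 ^ b with hc
  have hc0 : 0 ≤ c := by positivity
  refine ⟨c * ∑ p ∈ Finset.range (b + 1), C p, (Finset.range (b + 1)).biUnion t,
    mul_nonneg hc0 (Finset.sum_nonneg fun _ _ => hC _), fun φ z => ?_⟩
  have key := Real.pow_mul_norm_iteratedFDeriv_fourier_le (f := (slice φ z.1 : W → ℂ))
    (K := ⊤) (N := ⊤) (k := 0) (n := b) ((slice φ z.1).smooth ⊤)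
    (fun k n _ _ => (slice φ z.1).integrable_pow_mul_iteratedFDeriv volume k n) le_top le_top
    (-(2 * Real.pi)⁻¹ • z.2)
  have hsum : ∑ q ∈ Finset.range (0 + 1) ×ˢ Finset.range (b + 1),
      ∫ v, ‖v‖ ^ q.1 * ‖iteratedFDeriv ℝ q.2 (slice φ z.1) v‖ =
      ∑ p ∈ Finset.range (b + 1), ∫ v, ‖iteratedFDeriv ℝ p (slice φ z.1) v‖ := by
    rw [Finset.sum_product]; simp
  rw [hsum, norm_iteratedFDeriv_zero, norm_smul, mul_pow] at key
  have hn : ‖-(2 * Real.pi)⁻¹‖ = (2 * Real.pi)⁻¹ := by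
    rw [norm_neg, Real.norm_of_nonneg (by positivity)]
  rw [hn] at key
  simp only [pow_zero, one_mul, Nat.cast_zero, mul_zero, zero_add] at key
  rw [invPartialFourier_eq, norm_mul, Complex.norm_real, Real.norm_of_nonneg (by positivity)]
  set X := ‖𝓕 (slice φ z.1 : W → ℂ) (-(2 * Real.pi)⁻¹ • z.2)‖
  have key2 : ‖z.2‖ ^ b * X ≤ (2 * Real.pi) ^ b * (2 ^ b *
      ∑ p ∈ Finset.range (b + 1), ∫ v, ‖iteratedFDeriv ℝ p (slice φ z.1) v‖) := by
    rw [inv_pow, mul_assoc, inv_mul_le_iff₀ (by positivity)] at key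
    exact key
  calc (1 + ‖z.1‖) ^ a * ‖z.2‖ ^ b * (((2 * Real.pi) ^ Module.finrank ℝ W : ℝ)⁻¹ * X)
      = ((2 * Real.pi) ^ Module.finrank ℝ W : ℝ)⁻¹ * (1 + ‖z.1‖) ^ a * (‖z.2‖ ^ b * X) := by ring
    _ ≤ ((2 * Real.pi) ^ Module.finrank ℝ W : ℝ)⁻¹ * (1 + ‖z.1‖) ^ a *
        ((2 * Real.pi) ^ b * (2 ^ b *
          ∑ p ∈ Finset.range (b + 1), ∫ v, ‖iteratedFDeriv ℝ p (slice φ z.1) v‖)) := by gcongr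
    _ = c * ∑ p ∈ Finset.range (b + 1),
          (1 + ‖z.1‖) ^ a * ∫ v, ‖iteratedFDeriv ℝ p (slice φ z.1) v‖ := by
        rw [← Finset.mul_sum]; ring
    _ ≤ c * ∑ p ∈ Finset.range (b + 1), C p *
          ((Finset.range (b + 1)).biUnion t).sup (schwartzSeminormFamily ℂ (E × W) ℂ) φ := by
        refine mul_le_mul_of_nonneg_left (Finset.sum_le_sum fun p hp => ?_) hc0
        refine (h p φ z.1).trans ?_
        refine mul_le_mul_of_nonneg_left ?_ (hC p)
        exact Seminorm.le_def.1 (Finset.sup_mono (Finset.subset_biUnion_of_mem t hp)) φ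
    _ = _ := by rw [← Finset.sum_mul]; ring

lemma exists_invPartialFourier_le' (N : ℕ) : ∃ (C : ℝ) (t : Finset (ℕ × ℕ)), 0 ≤ C ∧
    ∀ (φ : 𝓢(E × W, ℂ)) (z : E × W),
      (1 + ‖z‖) ^ N * ‖invPartialFourier φ z‖ ≤
        C * t.sup (schwartzSeminormFamily ℂ (E × W) ℂ) φ := by
  obtain ⟨C₁, t₁, hC₁, h₁⟩ := exists_invPartialFourier_le (E := E) (W := W) N 0
  obtain ⟨C₂, t₂, hC₂, h₂⟩ := exists_invPartialFourier_le (E := E) (W := W) 0 N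
  refine ⟨2 ^ N * (C₁ + C₂), t₁ ∪ t₂, by positivity, fun φ z => ?_⟩
  have e1 := (h₁ φ z).trans (mul_le_mul_of_nonneg_left (Seminorm.le_def.1
    (Finset.sup_mono (Finset.subset_union_left (s₂ := t₂))) φ) hC₁)
  have e2 := (h₂ φ z).trans (mul_le_mul_of_nonneg_left (Seminorm.le_def.1
    (Finset.sup_mono (Finset.subset_union_right (s₁ := t₁))) φ) hC₂)
  simp only [pow_zero, mul_one, one_mul] at e1 e2
  set X := ‖invPartialFourier φ z‖
  have hX : 0 ≤ X := norm_nonneg _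
  have hz : (1 + ‖z‖) ^ N ≤ 2 ^ N * ((1 + ‖z.1‖) ^ N + ‖z.2‖ ^ N) := by
    rcases le_total ‖z.2‖ (1 + ‖z.1‖) with hc | hc
    · have : 1 + ‖z‖ ≤ 2 * (1 + ‖z.1‖) := by
        rw [Prod.norm_def]
        have := norm_nonneg z.1
        rcases max_cases ‖z.1‖ ‖z.2‖ with ⟨h, _⟩ | ⟨h, _⟩ <;> rw [h] <;> linarith
      calc (1 + ‖z‖) ^ N ≤ (2 * (1 + ‖z.1‖)) ^ N := by gcongr
        _ = 2 ^ N * (1 + ‖z.1‖) ^ N := mul_pow _ _ _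
        _ ≤ _ := by gcongr; exact le_add_of_nonneg_right (by positivity)
    · have : 1 + ‖z‖ ≤ 2 * ‖z.2‖ := by
        rw [Prod.norm_def]
        have := norm_nonneg z.1
        rcases max_cases ‖z.1‖ ‖z.2‖ with ⟨h, _⟩ | ⟨h, _⟩ <;> rw [h] <;> linarith
      calc (1 + ‖z‖) ^ N ≤ (2 * ‖z.2‖) ^ N := by gcongr
        _ = 2 ^ N * ‖z.2‖ ^ N := mul_pow _ _ _
        _ ≤ _ := by gcongr; exact le_add_of_nonneg_left (by positivity)
  calc (1 + ‖z‖) ^ N * X ≤ 2 ^ N * ((1 + ‖z.1‖) ^ N + ‖z.2‖ ^ N) * X := by gcongr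
    _ = 2 ^ N * ((1 + ‖z.1‖) ^ N * X + ‖z.2‖ ^ N * X) := by ring
    _ ≤ _ := by rw [mul_assoc, add_mul]; gcongr

variable [FiniteDimensional ℝ E] [MeasurableSpace E] [BorelSpace E]

lemma aestronglyMeasurable_invPartialFourier (μ : Measure (E × W)) (φ : 𝓢(E × W, ℂ)) :
    AEStronglyMeasurable (invPartialFourier (φ : E × W → ℂ)) μ := by
  refine (StronglyMeasurable.const_mul ?_ _).aestronglyMeasurable
  have hc : Continuous (fun q : (E × W) × W =>
      Complex.exp (Complex.I * (inner ℝ q.1.2 q.2 : ℝ)) * φ (q.1.1, q.2)) := by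
    have := φ.continuous
    fun_prop
  exact hc.stronglyMeasurable.integral_prod_right'

variable (μ : Measure (E × W)) [μ.HasTemperateGrowth]

lemma exists_mul_invPartialFourier_le {g : E × W → ℂ}
    (hg : ∃ (C : ℝ) (m : ℕ), ∀ z, ‖g z‖ ≤ C * (1 + ‖z‖) ^ m) :
    ∃ (C : ℝ) (t : Finset (ℕ × ℕ)), 0 ≤ C ∧ ∀ (φ : 𝓢(E × W, ℂ)) (z : E × W),
      ‖g z * invPartialFourier φ z‖ ≤ C * t.sup (schwartzSeminormFamily ℂ (E × W) ℂ) φ *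
        (1 + ‖z‖) ^ (-(μ.integrablePower : ℝ)) := by
  obtain ⟨C, m, hm⟩ := hg
  have hC : 0 ≤ C := by
    have := (norm_nonneg _).trans (hm 0)
    simpa using this
  obtain ⟨C', t, hC', h⟩ := exists_invPartialFourier_le' (E := E) (W := W)
    (m + μ.integrablePower)
  refine ⟨C * C', t, by positivity, fun φ z => ?_⟩
  have h1 := h φ z
  rw [Real.rpow_neg (by positivity), Real.rpow_natCast, ← div_eq_mul_inv,
      le_div_iff₀ (by positivity), norm_mul]
  calc ‖g z‖ * ‖invPartialFourier φ z‖ * (1 + ‖z‖) ^ μ.integrablePower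
      ≤ C * (1 + ‖z‖) ^ m * ‖invPartialFourier φ z‖ * (1 + ‖z‖) ^ μ.integrablePower := by
        gcongr; exact hm z
    _ = C * ((1 + ‖z‖) ^ (m + μ.integrablePower) * ‖invPartialFourier φ z‖) := by
        rw [pow_add]; ring
    _ ≤ C * (C' * _) := by gcongr
    _ = _ := by ring

lemma integrable_mul_invPartialFourier {g : E × W → ℂ} (hgm : AEStronglyMeasurable g μ)
    (hg : ∃ (C : ℝ) (m : ℕ), ∀ z, ‖g z‖ ≤ C * (1 + ‖z‖) ^ m) (φ : 𝓢(E × W, ℂ)) :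
    Integrable (fun z => g z * invPartialFourier φ z) μ := by
  obtain ⟨C, t, _, h⟩ := exists_mul_invPartialFourier_le μ hg
  exact ((Measure.integrable_pow_neg_integrablePower μ).const_mul _).mono'
    (hgm.mul (aestronglyMeasurable_invPartialFourier μ φ)) (Eventually.of_forall (h φ))

/-- The tempered distribution `u` whose partial Fourier transform is the measurable function `g` of
polynomial growth: `⟨u, φ⟩ = ∫ g · F⁻¹φ`, where `F⁻¹` is the inverse partial Fourier transform. -/
def ofPartialFourier (g : E × W → ℂ) (hgm : AEStronglyMeasurable g μ)
    (hg : ∃ (C : ℝ) (m : ℕ), ∀ z, ‖g z‖ ≤ C * (1 + ‖z‖) ^ m) : 𝓢'(E × W, ℂ) :=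
  ContinuousLinearMap.toPointwiseConvergenceCLM _ _ _ _ <|
    SchwartzMap.mkCLMtoNormedSpace (𝕜 := ℂ) (σ := RingHom.id ℂ)
      (fun φ : 𝓢(E × W, ℂ) => ∫ z, g z * invPartialFourier φ z ∂μ)
      (fun φ ψ => by
        rw [← integral_add (integrable_mul_invPartialFourier μ hgm hg φ)
          (integrable_mul_invPartialFourier μ hgm hg ψ)]
        simp only [invPartialFourier_add, mul_add])
      (fun c φ => by
        rw [RingHom.id_apply, smul_eq_mul, ← integral_const_mul]
        simp only [invPartialFourier_smul, mul_left_comm c])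
      (by
        obtain ⟨C, t, hC, h⟩ := exists_mul_invPartialFourier_le μ hg
        refine ⟨t, C * ∫ z, (1 + ‖z‖) ^ (-(μ.integrablePower : ℝ)) ∂μ,
          mul_nonneg hC (integral_nonneg fun z => by positivity), fun φ => ?_⟩
        refine (norm_integral_le_of_norm_le
          ((Measure.integrable_pow_neg_integrablePower μ).const_mul _)
          (Eventually.of_forall (h φ))).trans ?_
        rw [integral_const_mul]
        exact le_of_eq (by ring))

end PartialFourier

section Laguerre

/-- The generalized Laguerre polynomial `L_k^{(p)}`. -/
def laguerrePoly (k p : ℕ) (σ : ℝ) : ℝ :=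
  ∑ m ∈ Finset.range (k + 1), ((k + p).choose (k - m) : ℝ) * (-σ) ^ m / (m.factorial : ℝ)

/-- The Laguerre function
`l_k^{(p)}(σ) = (Γ(k+1) / Γ(k+p+1))^{1/2} L_k^{(p)}(σ) σ^{p/2} e^{-σ/2}`, for `σ ≥ 0`. -/
def laguerreFun (k p : ℕ) (σ : ℝ) : ℝ :=
  √(Real.Gamma (k + 1) / Real.Gamma (k + p + 1)) * laguerrePoly k p σ *
    σ ^ ((p : ℝ) / 2) * Real.exp (-σ / 2)

/-- The Laguerre function of the plane, `(2t/π) (sgn p)^p l_k^{(|p|)}(2t|z|²) e^{ipθ}`, where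
`z = |z| e^{iθ} = y₁ + i y₂` stands for the point `(y₁, y₂)`, and `t = |τ|`. -/
def planeLaguerre (k : ℕ) (p : ℤ) (z : ℂ) (t : ℝ) : ℂ :=
  ((2 * t / Real.pi * (SignType.sign p : ℝ) ^ p * laguerreFun k p.natAbs (2 * t * ‖z‖ ^ 2) : ℝ) : ℂ) *
    Complex.exp (Complex.I * p * Complex.arg z)

lemma exists_pow_mul_exp_le (m : ℕ) : ∃ C : ℝ, 0 ≤ C ∧ ∀ σ : ℝ, 0 ≤ σ →
    σ ^ m * Real.exp (-σ / 2) ≤ C := by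
  refine ⟨m.factorial * 2 ^ m, by positivity, fun σ hσ => ?_⟩
  have h := Real.pow_div_factorial_le_exp (x := σ / 2) (by positivity) m
  rw [neg_div, Real.exp_neg, ← div_eq_mul_inv, div_le_iff₀ (Real.exp_pos _)]
  rw [div_pow, div_div, div_le_iff₀ (by positivity)] at h
  linarith

lemma exists_laguerreFun_le (k p : ℕ) : ∃ C : ℝ, 0 ≤ C ∧ ∀ σ : ℝ, 0 ≤ σ →
    |laguerreFun k p σ| ≤ C := by
  choose D hD0 hD using exists_pow_mul_exp_le
  set c := √(Real.Gamma (k + 1) / Real.Gamma (k + p + 1)) with hc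
  have hc0 : 0 ≤ c := Real.sqrt_nonneg _
  refine ⟨c * ∑ m ∈ Finset.range (k + 1), ((k + p).choose (k - m) : ℝ) / (m.factorial : ℝ) *
    (D m + D (m + p)), mul_nonneg hc0 (Finset.sum_nonneg fun m _ => mul_nonneg (by positivity)
      (add_nonneg (hD0 _) (hD0 _))), fun σ hσ => ?_⟩
  have hpow : σ ^ ((p : ℝ) / 2) ≤ 1 + σ ^ p := by
    rcases le_total σ 1 with h | h
    · have := Real.rpow_le_one hσ h (z := (p : ℝ) / 2) (by positivity)
      have : 0 ≤ σ ^ p := by positivity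
      linarith
    · have : σ ^ ((p : ℝ) / 2) ≤ σ ^ (p : ℝ) := Real.rpow_le_rpow_of_exponent_le h
        (by have : (0 : ℝ) ≤ p := by positivity
            linarith)
      rw [Real.rpow_natCast] at this
      linarith
  have hpoly : |laguerrePoly k p σ| ≤
      ∑ m ∈ Finset.range (k + 1), ((k + p).choose (k - m) : ℝ) / (m.factorial : ℝ) * σ ^ m := by
    refine (Finset.abs_sum_le_sum_abs _ _).trans (Finset.sum_le_sum fun m _ => le_of_eq ?_)
    rw [abs_div, abs_mul, abs_pow, abs_neg, abs_of_nonneg hσ, Nat.abs_cast, Nat.abs_cast]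
    ring
  have hr : 0 ≤ σ ^ ((p : ℝ) / 2) := Real.rpow_nonneg hσ _
  rw [laguerreFun, abs_mul, abs_mul, abs_mul, abs_of_nonneg hc0, abs_of_nonneg hr,
    abs_of_nonneg (Real.exp_pos _).le]
  calc c * |laguerrePoly k p σ| * σ ^ ((p : ℝ) / 2) * Real.exp (-σ / 2)
      ≤ c * (∑ m ∈ Finset.range (k + 1), ((k + p).choose (k - m) : ℝ) / (m.factorial : ℝ) * σ ^ m)
        * (1 + σ ^ p) * Real.exp (-σ / 2) := by gcongr
    _ = c * ∑ m ∈ Finset.range (k + 1), ((k + p).choose (k - m) : ℝ) / (m.factorial : ℝ) *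
        (σ ^ m * Real.exp (-σ / 2) + σ ^ (m + p) * Real.exp (-σ / 2)) := by
        rw [mul_assoc c, mul_assoc c, Finset.sum_mul, Finset.sum_mul]
        congr 1
        refine Finset.sum_congr rfl fun m _ => ?_
        ring
    _ ≤ _ := by
        gcongr
        · exact hD _ _ hσ
        · exact hD _ _ hσ

lemma measurable_planeLaguerre (k : ℕ) (p : ℤ) :
    Measurable fun q : ℂ × ℝ => planeLaguerre k p q.1 q.2 := by
  unfold planeLaguerre laguerreFun laguerrePoly
  have := Complex.measurable_arg
  fun_prop

lemma exists_planeLaguerre_le (k : ℕ) (p : ℤ) : ∃ C : ℝ, 0 ≤ C ∧ ∀ (z : ℂ) (t : ℝ), 0 ≤ t →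
    ‖planeLaguerre k p z t‖ ≤ C * t := by
  obtain ⟨C, hC, h⟩ := exists_laguerreFun_le k p.natAbs
  refine ⟨2 / Real.pi * C, by positivity, fun z t ht => ?_⟩
  have he : ‖Complex.exp (Complex.I * p * Complex.arg z)‖ = 1 := by
    have : Complex.I * p * Complex.arg z = ((p * Complex.arg z : ℝ) : ℂ) * Complex.I := by
      push_cast; ring
    rw [this, Complex.norm_exp_ofReal_mul_I]
  rw [planeLaguerre, norm_mul, he, mul_one, Complex.norm_real, norm_mul, norm_mul]
  have hs : ‖(SignType.sign p : ℝ) ^ p‖ ≤ 1 := by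
    rw [norm_zpow]
    rcases lt_trichotomy p 0 with hp | hp | hp
    · simp [sign_neg hp]
    · simp [hp]
    · simp [sign_pos hp]
  rw [Real.norm_of_nonneg (by positivity)]
  calc 2 * t / Real.pi * ‖(SignType.sign p : ℝ) ^ p‖ * ‖laguerreFun k p.natAbs (2 * t * ‖z‖ ^ 2)‖
      ≤ 2 * t / Real.pi * 1 * C := by
        gcongr
        exact h _ (by positivity)
    _ = _ := by ring

end Laguerre

section Group

variable {n r : ℕ}

/-- `ℝ^{2n}`. -/
abbrev Horiz (n : ℕ) : Type := EuclideanSpace ℝ (Fin (2 * n))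

/-- `ℝ^r`. -/
abbrev Center (r : ℕ) : Type := EuclideanSpace ℝ (Fin r)

instance : (volume : Measure (Horiz n × Center r)).IsAddHaarMeasure :=
  inferInstanceAs ((volume : Measure (Horiz n)).prod (volume : Measure (Center r))).IsAddHaarMeasure

/-- The multiplication `(x, t) · (y, s) = (x + y, t + s + 2 B(x, y))` on `ℝ^{2n} × ℝ^r`. -/
def gmul (B : Horiz n →L[ℝ] Horiz n →L[ℝ] Center r) (u v : Horiz n × Center r) :
    Horiz n × Center r :=
  (u.1 + v.1, u.2 + v.2 + (2 : ℝ) • B u.1 v.1)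

/-- The inverse for `gmul B`, when `B` is skew-symmetric. -/
def ginv (u : Horiz n × Center r) : Horiz n × Center r := (-u.1, -u.2)

/-- The bilinear form `B^τ(x, y) = ∑_β τ_β B^β(x, y)`. -/
def formAt (B : Horiz n →L[ℝ] Horiz n →L[ℝ] Center r) (τ : Center r) (x y : Horiz n) : ℝ :=
  ∑ β, τ β * B x y β

lemma formAt_eq_inner (B : Horiz n →L[ℝ] Horiz n →L[ℝ] Center r) (τ : Center r) (x y : Horiz n) :
    formAt B τ x y = inner ℝ τ (B x y) := by
  simp [formAt, PiLp.inner_apply, mul_comm]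

/-- Non-degeneracy of the (skew-symmetric) form `B^τ`. -/
def NondegenerateAt (B : Horiz n →L[ℝ] Horiz n →L[ℝ] Center r) (τ : Center r) : Prop :=
  ∀ x, (∀ y, formAt B τ x y = 0) → x = 0

/-- For a family `τ ↦ {v₁^τ, …, v_{2n}^τ}` of orthonormal bases, where `(v_{2j-1}^τ, v_{2j}^τ)` is
`(v τ (j, 0), v τ (j, 1))`: the numbers `μ_j(τ) = -B^τ(v_{2j-1}^τ, v_{2j}^τ)`. -/
def muOf (B : Horiz n →L[ℝ] Horiz n →L[ℝ] Center r)
    (v : Center r → OrthonormalBasis (Fin n × Fin 2) ℝ (Horiz n)) (τ : Center r) (j : Fin n) : ℝ :=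
  -formAt B τ (v τ (j, 0)) (v τ (j, 1))

/-- A choice `τ ↦ {v₁^τ, …, v_{2n}^τ}` of orthonormal bases of `ℝ^{2n}`, depending measurably on
`τ` and only on the direction `τ / |τ|`, that normalize `B^τ` for almost all `τ`: in the
`τ`-coordinates `x_k^τ`, which are `(basis τ).repr x k`,
`B^τ(x, y) = ∑_j μ_j(τ) (-x_{2j-1}^τ y_{2j}^τ + x_{2j}^τ y_{2j-1}^τ)`, with `μ_j(τ) ≥ 0`. -/
structure NormalizingFrame (B : Horiz n →L[ℝ] Horiz n →L[ℝ] Center r) where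
  basis : Center r → OrthonormalBasis (Fin n × Fin 2) ℝ (Horiz n)
  basis_smul : ∀ (c : ℝ) (τ : Center r), 0 < c → basis (c • τ) = basis τ
  aemeasurable_basis : ∀ i, AEMeasurable (fun τ => basis τ i) volume
  normalizes : ∀ᵐ τ : Center r, (∀ j, 0 ≤ muOf B basis τ j) ∧ ∀ x y, formAt B τ x y =
    ∑ j, muOf B basis τ j * (-((basis τ).repr x (j, 0) * (basis τ).repr y (j, 1)) +
      (basis τ).repr x (j, 1) * (basis τ).repr y (j, 0))

/-- The direction `τ / |τ|`. -/
def dir (τ : Center r) : Center r := ‖τ‖⁻¹ • τ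

lemma formAt_eq_norm_mul (B : Horiz n →L[ℝ] Horiz n →L[ℝ] Center r) (τ : Center r)
    (x y : Horiz n) : formAt B τ x y = ‖τ‖ * formAt B (dir τ) x y := by
  simp only [formAt_eq_inner, dir, real_inner_smul_left]
  rcases eq_or_ne τ 0 with rfl | h
  · simp
  · rw [← mul_assoc, mul_inv_cancel₀ (norm_ne_zero_iff.2 h), one_mul]

lemma measurable_dir : Measurable (dir : Center r → Center r) := by
  unfold dir; fun_prop

lemma norm_dir_le (τ : Center r) : ‖dir τ‖ ≤ 1 := by
  rw [dir, norm_smul, norm_inv, norm_norm]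
  exact inv_mul_le_one

section Existence

variable (B : Horiz n →L[ℝ] Horiz n →L[ℝ] Center r)

lemma continuous_formAt :
    Continuous fun q : Center r × Horiz n × Horiz n => formAt B q.1 q.2.1 q.2.2 := by
  simp only [formAt_eq_inner]
  have : Continuous fun q : Center r × Horiz n × Horiz n => B q.2.1 q.2.2 :=
    B.isBoundedBilinearMap.continuous.comp continuous_snd
  fun_prop

lemma formAt_skew (hB : ∀ x y, B x y = -B y x) (τ : Center r) (x y : Horiz n) :
    formAt B τ x y = -formAt B τ y x := by
  rw [formAt_eq_inner, formAt_eq_inner, hB x y, inner_neg_right]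

lemma eq_zero_of_max {a b : ℝ} (h : ∀ c s : ℝ, c ^ 2 + s ^ 2 = 1 → a * c + b * s ≤ a) : b = 0 := by
  set ρ := √(a ^ 2 + b ^ 2) with hρ
  have h2 : ρ ^ 2 = a ^ 2 + b ^ 2 := Real.sq_sqrt (by positivity)
  rcases eq_or_ne ρ 0 with h0 | h0
  · rw [h0] at h2; nlinarith
  · have hpos : 0 < ρ := lt_of_le_of_ne (Real.sqrt_nonneg _) h0.symm
    have h1 := h (a / ρ) (b / ρ) (by field_simp; linarith)
    have h3 : a * (a / ρ) + b * (b / ρ) = ρ := by field_simp; linarith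
    rw [h3] at h1
    nlinarith

/-- A subspace of dimension at least two contains an orthonormal pair `(u, w)` whose orthogonal
complement in the subspace is orthogonal to `u`, `w` with respect to the form. -/
lemma exists_pair (hB : ∀ x y, B x y = -B y x) (τ : Center r) (S : Submodule ℝ (Horiz n))
    (hS : 2 ≤ Module.finrank ℝ S) :
    ∃ u ∈ S, ∃ w ∈ S, ‖u‖ = 1 ∧ ‖w‖ = 1 ∧ inner ℝ u w = 0 ∧ 0 ≤ -formAt B τ u w ∧
      ∀ z ∈ S, ‖z‖ = 1 → inner ℝ u z = 0 → inner ℝ w z = 0 →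
        formAt B τ u z = 0 ∧ formAt B τ w z = 0 := by
  set P : Set (Horiz n × Horiz n) :=
    {q | q.1 ∈ S ∧ q.2 ∈ S ∧ ‖q.1‖ = 1 ∧ ‖q.2‖ = 1 ∧ inner ℝ q.1 q.2 = 0} with hP
  have hSc : IsClosed (S : Set (Horiz n)) := S.closed_of_finiteDimensional
  have hcl : IsClosed P := by
    refine (hSc.preimage continuous_fst).inter ((hSc.preimage continuous_snd).inter
      ((isClosed_eq (by fun_prop) continuous_const).inter
        ((isClosed_eq (by fun_prop) continuous_const).inter
          (isClosed_eq (by fun_prop) continuous_const))))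
  have hcpt : IsCompact P := by
    refine (isCompact_closedBall (0 : Horiz n × Horiz n) 1).of_isClosed_subset hcl fun q hq => ?_
    rw [mem_closedBall_zero_iff, Prod.norm_def, hq.2.2.1, hq.2.2.2.1, max_self]
  have hne : P.Nonempty := by
    let b := stdOrthonormalBasis ℝ S
    let i : Fin (Module.finrank ℝ S) := ⟨0, by omega⟩
    let j : Fin (Module.finrank ℝ S) := ⟨1, by omega⟩
    have hij : i ≠ j := by simp [i, j]
    refine ⟨((b i : S), (b j : S)), (b i).2, (b j).2, ?_, ?_, ?_⟩
    · exact b.orthonormal.1 i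
    · exact b.orthonormal.1 j
    · exact b.orthonormal.2 hij
  have hcont : Continuous fun q : Horiz n × Horiz n => -formAt B τ q.1 q.2 :=
    ((continuous_formAt B).comp (continuous_const.prodMk continuous_id)).neg
  obtain ⟨⟨u, w⟩, ⟨hu, hw, hu1, hw1, huw⟩, hmax⟩ := hcpt.exists_isMaxOn hne hcont.continuousOn
  have hmax' : ∀ u' w' : Horiz n, u' ∈ S → w' ∈ S → ‖u'‖ = 1 → ‖w'‖ = 1 → inner ℝ u' w' = 0 →
      -formAt B τ u' w' ≤ -formAt B τ u w := fun u' w' h1 h2 h3 h4 h5 =>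
    hmax (a := (u', w')) ⟨h1, h2, h3, h4, h5⟩
  have hadd : ∀ (x y z : Horiz n) (c s : ℝ), formAt B τ (c • x + s • y) z =
      c * formAt B τ x z + s * formAt B τ y z := by
    intro x y z c s
    simp [formAt_eq_inner, inner_add_right, inner_smul_right]
  have hadd' : ∀ (x y z : Horiz n) (c s : ℝ), formAt B τ z (c • x + s • y) =
      c * formAt B τ z x + s * formAt B τ z y := by
    intro x y z c s
    simp [formAt_eq_inner, inner_add_right, inner_smul_right]
  have hnorm : ∀ (x y : Horiz n) (c s : ℝ), ‖x‖ = 1 → ‖y‖ = 1 → inner ℝ x y = 0 →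
      c ^ 2 + s ^ 2 = 1 → ‖c • x + s • y‖ = 1 := by
    intro x y c s hx hy hxy hcs
    have : ‖c • x + s • y‖ ^ 2 = 1 := by
      rw [norm_add_sq_real, norm_smul, norm_smul, hx, hy, real_inner_smul_left,
        real_inner_smul_right, hxy]
      simp [hcs]
    nlinarith [norm_nonneg (c • x + s • y)]
  refine ⟨u, hu, w, hw, hu1, hw1, huw, ?_, fun z hz hz1 huz hwz => ⟨?_, ?_⟩⟩
  · have := hmax' w u hw hu hw1 hu1 (by rw [real_inner_comm]; exact huw)
    rw [formAt_skew B hB τ w u] at this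
    linarith
  · have : -formAt B τ u z = 0 := by
      refine eq_zero_of_max (a := -formAt B τ u w) fun c s hcs => ?_
      have := hmax' u (c • w + s • z) hu (S.add_mem (S.smul_mem _ hw) (S.smul_mem _ hz)) hu1
        (hnorm w z c s hw1 hz1 hwz hcs) (by simp [inner_add_right, inner_smul_right, huw, huz])
      rw [hadd'] at this
      linarith
    linarith
  · have : -formAt B τ z w = 0 := by
      refine eq_zero_of_max (a := -formAt B τ u w) fun c s hcs => ?_
      have := hmax' (c • u + s • z) w (S.add_mem (S.smul_mem _ hu) (S.smul_mem _ hz)) hw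
        (hnorm u z c s hu1 hz1 huz hcs) hw1
        (by rw [inner_add_left, real_inner_smul_left, real_inner_smul_left, huw,
              real_inner_comm, hwz]; simp)
      rw [hadd] at this
      linarith
    rw [formAt_skew B hB]
    linarith

/-- The family `e` is in normal form with respect to `B^τ`. -/
def IsNormalFamily (τ : Center r) {m : ℕ} (e : Fin m × Fin 2 → Horiz n) : Prop :=
  (∀ j, 0 ≤ -formAt B τ (e (j, 0)) (e (j, 1))) ∧
    ∀ j l, j ≠ l → ∀ a b, formAt B τ (e (j, a)) (e (l, b)) = 0

lemma exists_normalFamily (hB : ∀ x y, B x y = -B y x) (τ : Center r) (m : ℕ) :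
    ∀ S : Submodule ℝ (Horiz n), Module.finrank ℝ S = 2 * m →
      ∃ e : Fin m × Fin 2 → Horiz n, Orthonormal ℝ e ∧ (∀ i, e i ∈ S) ∧ IsNormalFamily B τ e := by
  induction m with
  | zero => exact fun S _ => ⟨fun i => i.1.elim0, ⟨fun i => i.1.elim0, fun i => i.1.elim0⟩,
      fun i => i.1.elim0, fun j => j.elim0, fun j => j.elim0⟩
  | succ m ih =>
    intro S hS
    obtain ⟨u, hu, w, hw, hu1, hw1, huw, hpos, hz⟩ := exists_pair B hB τ S (by omega)
    set p : Fin 2 → Horiz n := ![u, w] with hp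
    have hpo : Orthonormal ℝ p := by
      rw [orthonormal_iff_ite]
      intro i j
      fin_cases i <;> fin_cases j <;> simp [hp, huw, hu1, hw1, real_inner_comm]
    set T : Submodule ℝ (Horiz n) := Submodule.span ℝ (Set.range p) with hT
    have hTS : T ≤ S := by
      rw [hT, Submodule.span_le]
      rintro _ ⟨i, rfl⟩
      fin_cases i
      · exact hu
      · exact hw
    have hTr : Module.finrank ℝ T = 2 := by
      rw [hT, finrank_span_eq_card hpo.linearIndependent]; rfl
    have hfin := Submodule.finrank_add_inf_finrank_orthogonal hTS
    obtain ⟨e, heo, heS, hen⟩ := ih (Tᗮ ⊓ S) (by omega)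
    have hpe : ∀ a i, inner ℝ (p a) (e i) = 0 := fun a i =>
      (Submodule.mem_orthogonal T _).1 (heS i).1 _ (Submodule.subset_span ⟨a, rfl⟩)
    have hfe : ∀ a i, formAt B τ (p a) (e i) = 0 := by
      intro a i
      have := hz (e i) (heS i).2 (heo.1 i) (hpe 0 i) (hpe 1 i)
      fin_cases a
      · exact this.1
      · exact this.2
    refine ⟨fun i => Fin.cases (motive := fun _ => Horiz n) (p i.2) (fun j => e (j, i.2)) i.1,
      ?_, ?_, ?_, ?_⟩
    · rw [orthonormal_iff_ite] at hpo heo ⊢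
      rintro ⟨i, a⟩ ⟨j, b⟩
      refine Fin.cases ?_ (fun i => ?_) i <;> refine Fin.cases ?_ (fun j => ?_) j
      · simpa using hpo a b
      · simpa [Fin.ext_iff] using hpe a (j, b)
      · rw [real_inner_comm]
        simpa [Fin.ext_iff] using hpe b (i, a)
      · simpa using heo (i, a) (j, b)
    · rintro ⟨i, a⟩
      refine Fin.cases ?_ (fun i => ?_) i
      · exact hTS (Submodule.subset_span ⟨a, rfl⟩)
      · exact (heS _).2
    · intro j
      refine Fin.cases ?_ (fun j => ?_) j
      · exact hpos
      · exact hen.1 j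
    · intro i j hij a b
      revert hij
      refine Fin.cases ?_ (fun i => ?_) i <;> refine Fin.cases ?_ (fun j => ?_) j
      · intro h; exact absurd rfl h
      · intro _; exact hfe a (j, b)
      · intro _
        rw [formAt_skew B hB]
        simpa using hfe b (i, a)
      · intro h
        exact hen.2 i j (fun h' => h (by rw [h'])) a b

/-- Closed subsets of a product with a compact metric space, with non-empty fibres, have measurable
selections. -/
lemma exists_measurable_selection {X K : Type*} [TopologicalSpace X] [MeasurableSpace X]
    [BorelSpace X] [MetricSpace K] [CompactSpace K] [MeasurableSpace K] [BorelSpace K]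
    (G : Set (X × K)) (hG : IsClosed G) (hne : ∀ x, ∃ y, (x, y) ∈ G) :
    ∃ s : X → K, Measurable s ∧ ∀ x, (x, s x) ∈ G := by
  rcases isEmpty_or_nonempty X with hX | ⟨⟨x₀⟩⟩
  · exact ⟨fun x => isEmptyElim x, measurable_of_empty _, fun x => isEmptyElim x⟩
  have : Nonempty K := ⟨(hne x₀).choose⟩
  obtain ⟨f, hf, hfs⟩ := exists_nat_bool_continuous_surjective_of_compact K
  set γ : cantorSet → K := f ∘ cantorSetHomeomorphNatToBool with hγ
  have hγc : Continuous γ := hf.comp cantorSetHomeomorphNatToBool.continuous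
  have hγs : Function.Surjective γ := hfs.comp cantorSetHomeomorphNatToBool.surjective
  have : CompactSpace cantorSet := isCompact_iff_compactSpace.1 isCompact_cantorSet
  set G' : Set (X × cantorSet) := {q | (q.1, γ q.2) ∈ G} with hG'
  have hG'c : IsClosed G' := hG.preimage (by fun_prop)
  have hmin : ∀ x, ∃ c : cantorSet, (x, c) ∈ G' ∧ ∀ c', (x, c') ∈ G' → c ≤ c' := by
    intro x
    have hcl : IsClosed {c : cantorSet | (x, c) ∈ G'} := hG'c.preimage (by fun_prop)
    have hn : {c : cantorSet | (x, c) ∈ G'}.Nonempty := by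
      obtain ⟨y, hy⟩ := hne x
      obtain ⟨c, rfl⟩ := hγs y
      exact ⟨c, hy⟩
    obtain ⟨c, hc, hc'⟩ := hcl.isCompact.exists_isMinOn hn continuous_id.continuousOn
    exact ⟨c, hc, fun c' h => hc' h⟩
  choose m hm hm' using hmin
  have hmeas : Measurable m := by
    have h : Measurable fun x => ((m x : cantorSet) : ℝ) := by
      refine measurable_of_Iic fun a => ?_
      have heq : (fun x => ((m x : cantorSet) : ℝ)) ⁻¹' Set.Iic a =
          Prod.fst '' (G' ∩ {q | (q.2 : ℝ) ≤ a}) := by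
        ext x
        constructor
        · exact fun hx => ⟨(x, m x), ⟨hm x, hx⟩, rfl⟩
        · rintro ⟨⟨x', c⟩, ⟨h1, h2⟩, rfl⟩
          exact le_trans (Subtype.coe_le_coe.2 (hm' x' c h1)) h2
      rw [heq]
      exact (isClosedMap_fst_of_compactSpace _ (hG'c.inter
        (isClosed_le (by fun_prop) continuous_const))).measurableSet
    exact h.subtype_mk
  exact ⟨fun x => γ (m x), hγc.measurable.comp hmeas, hm⟩

/-- Every skew-symmetric `B` admits a measurable choice of normalizing orthonormal bases. -/
theorem nonempty_normalizingFrame (hB : ∀ x y, B x y = -B y x) :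
    Nonempty (NormalizingFrame B) := by
  set K : Set (Fin n × Fin 2 → Horiz n) := {e | Orthonormal ℝ e} with hK
  have hKc : IsCompact K := by
    have hcl : IsClosed K := by
      have : K = ⋂ i, ⋂ j, {e | inner ℝ (e i) (e j) = if i = j then (1 : ℝ) else 0} := by
        ext e
        simp [hK, orthonormal_iff_ite]
      rw [this]
      refine isClosed_iInter fun i => isClosed_iInter fun j => isClosed_eq ?_ continuous_const
      fun_prop
    refine (isCompact_closedBall (0 : Fin n × Fin 2 → Horiz n) 1).of_isClosed_subset hcl
      fun e he => ?_
    rw [mem_closedBall_zero_iff, pi_norm_le_iff_of_nonneg zero_le_one]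
    exact fun i => (he.1 i).le
  have : CompactSpace K := isCompact_iff_compactSpace.1 hKc
  have hform : ∀ i j, Continuous fun q : Center r × K =>
      formAt B q.1 ((q.2 : Fin n × Fin 2 → Horiz n) i) ((q.2 : Fin n × Fin 2 → Horiz n) j) := by
    intro i j
    have hc : ∀ i, Continuous fun q : Center r × K => (q.2 : Fin n × Fin 2 → Horiz n) i :=
      fun i => (continuous_apply i).comp (continuous_subtype_val.comp continuous_snd)
    exact (continuous_formAt B).comp (continuous_fst.prodMk ((hc i).prodMk (hc j)))
  obtain ⟨s, hs, hsG⟩ := exists_measurable_selection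
    {q : Center r × K | IsNormalFamily B q.1 (q.2 : Fin n × Fin 2 → Horiz n)}
    (by
      have : {q : Center r × K | IsNormalFamily B q.1 (q.2 : Fin n × Fin 2 → Horiz n)} =
          (⋂ j, {q | 0 ≤ -formAt B q.1 (q.2.1 (j, 0)) (q.2.1 (j, 1))}) ∩
          ⋂ j, ⋂ l, ⋂ _ : j ≠ l, ⋂ a, ⋂ b, {q | formAt B q.1 (q.2.1 (j, a)) (q.2.1 (l, b)) = 0} := by
        ext q
        simp [IsNormalFamily]
      rw [this]
      refine (isClosed_iInter fun j => isClosed_le continuous_const (hform _ _).neg).inter ?_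
      exact isClosed_iInter fun j => isClosed_iInter fun l => isClosed_iInter fun _ =>
        isClosed_iInter fun a => isClosed_iInter fun b => isClosed_eq (hform _ _) continuous_const)
    (fun τ => by
      obtain ⟨e, he, _, hn⟩ := exists_normalFamily B hB τ n ⊤ (by simp)
      exact ⟨⟨e, he⟩, hn⟩)
  have hb : ∀ τ, ∃ b : OrthonormalBasis (Fin n × Fin 2) ℝ (Horiz n), ⇑b = (s (dir τ)).1 := by
    intro τ
    have h1 : Orthonormal ℝ (s (dir τ)).1 := (s (dir τ)).2
    obtain ⟨b, hb⟩ := Orthonormal.exists_orthonormalBasis_extension_of_card_eq (𝕜 := ℝ)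
      (ι := Fin n × Fin 2) (E := Horiz n) (by simp [mul_comm]) (v := (s (dir τ)).1)
      (s := Set.univ) (h1.comp _ Subtype.val_injective)
    exact ⟨b, funext fun i => hb i trivial⟩
  choose b₀ hb₀ using fun e : {e : Fin n × Fin 2 → Horiz n //
      ∃ b : OrthonormalBasis (Fin n × Fin 2) ℝ (Horiz n), ⇑b = e} => e.2
  refine ⟨⟨fun τ => b₀ ⟨_, hb τ⟩, fun c τ hc => ?_, fun i => ?_, ?_⟩⟩
  · have : dir (c • τ) = dir τ := by
      rw [dir, dir, norm_smul, Real.norm_of_nonneg hc.le, smul_smul, mul_inv, mul_comm c⁻¹,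
        mul_assoc, inv_mul_cancel₀ hc.ne', mul_one]
    simp only [this]
  · refine Measurable.aemeasurable ?_
    have : (fun τ => b₀ ⟨_, hb τ⟩ i) = fun τ => (s (dir τ)).1 i := by
      funext τ; rw [hb₀]
    rw [this]
    exact (measurable_pi_apply i).comp (measurable_subtype_coe.comp (hs.comp measurable_dir))
  · refine Eventually.of_forall fun τ => ?_
    have hn : IsNormalFamily B (dir τ) (s (dir τ)).1 := hsG (dir τ)
    set v := b₀ ⟨_, hb τ⟩ with hv
    have hvs : ⇑v = (s (dir τ)).1 := hb₀ _
    rw [← hvs] at hn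
    have hz : ∀ j l, j ≠ l → ∀ a b, formAt B τ (v (j, a)) (v (l, b)) = 0 := by
      intro j l h a b
      rw [formAt_eq_norm_mul, hn.2 j l h a b, mul_zero]
    have hd : ∀ x, formAt B τ x x = 0 := fun x => by
      have := formAt_skew B hB τ x x
      linarith
    refine ⟨fun j => ?_, fun x y => ?_⟩
    · rw [muOf, formAt_eq_norm_mul, ← mul_neg]
      exact mul_nonneg (norm_nonneg _) (hn.1 j)
    · conv_lhs => rw [← v.sum_repr x, ← v.sum_repr y]
      have hexp : formAt B τ (∑ i, v.repr x i • v i) (∑ i, v.repr y i • v i) =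
          ∑ i, ∑ k, v.repr x i * v.repr y k * formAt B τ (v i) (v k) := by
        simp only [formAt_eq_inner, map_sum, _root_.sum_apply, inner_sum,
          map_smul, _root_.smul_apply, real_inner_smul_right, Finset.mul_sum]
        rw [Finset.sum_comm]
        refine Finset.sum_congr rfl fun i _ => Finset.sum_congr rfl fun k _ => by ring
      rw [hexp, Fintype.sum_prod_type]
      refine Finset.sum_congr rfl fun j _ => ?_
      have hin : ∀ a, ∑ k, v.repr x (j, a) * v.repr y k * formAt B τ (v (j, a)) (v k) =
          ∑ b, v.repr x (j, a) * v.repr y (j, b) * formAt B τ (v (j, a)) (v (j, b)) := by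
        intro a
        rw [Fintype.sum_prod_type]
        refine Fintype.sum_eq_single j fun l hl => Finset.sum_eq_zero fun b _ => ?_
        rw [hz j l hl.symm, mul_zero]
      simp only [hin, Fin.sum_univ_two, hd, muOf]
      rw [formAt_skew B hB τ (v (j, 1)) (v (j, 0))]
      ring

end Existence

variable {B : Horiz n →L[ℝ] Horiz n →L[ℝ] Center r}

namespace NormalizingFrame

variable (F : NormalizingFrame B)

/-- `μ_j(τ)`. -/
def mu (τ : Center r) (j : Fin n) : ℝ := muOf B F.basis τ j

/-- The point `(y_{2j-1}^τ, y_{2j}^τ)` of the plane, as the complex number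
`y_{2j-1}^τ + i y_{2j}^τ`. -/
def coord (τ : Center r) (y : Horiz n) (j : Fin n) : ℂ :=
  ((F.basis τ).repr y (j, 0) : ℂ) + Complex.I * ((F.basis τ).repr y (j, 1) : ℂ)

/-- The partial Fourier transform of the exponential Laguerre distribution `𝓛_k^{(p)}`, at the point
`(y, τ)` of `ℝ^{2n} × ℝ^r`. -/
def laguerreFourier (k : Fin n → ℕ) (p : Fin n → ℤ) (z : Horiz n × Center r) : ℂ :=
  ∏ j, (F.mu (dir z.2) j : ℂ) *
    planeLaguerre (k j) (p j) ((√(F.mu (dir z.2) j) : ℂ) * F.coord z.2 z.1 j) ‖z.2‖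

lemma abs_mu_le (τ : Center r) (j : Fin n) : |F.mu τ j| ≤ ‖τ‖ * ‖B‖ := by
  rw [mu, muOf, abs_neg, formAt_eq_inner]
  refine (abs_real_inner_le_norm _ _).trans ?_
  gcongr
  refine (B.le_opNorm₂ _ _).trans ?_
  rw [(F.basis τ).orthonormal.1, (F.basis τ).orthonormal.1, mul_one, mul_one]

lemma aemeasurable_mu_dir (j : Fin n) : AEMeasurable fun τ => F.mu (dir τ) j := by
  have h : ∀ τ, F.mu (dir τ) j =
      -formAt B (dir τ) (F.basis τ (j, 0)) (F.basis τ (j, 1)) := by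
    intro τ
    rcases eq_or_ne τ 0 with rfl | hτ
    · simp [mu, muOf, formAt, dir]
    · rw [mu, muOf, dir, F.basis_smul _ _ (inv_pos.2 (norm_pos_iff.2 hτ))]
  simp only [h]
  exact ((continuous_formAt B).measurable.comp_aemeasurable
    (measurable_dir.aemeasurable.prodMk
      ((F.aemeasurable_basis (j, 0)).prodMk (F.aemeasurable_basis (j, 1))))).neg

lemma aestronglyMeasurable_laguerreFourier (k : Fin n → ℕ) (p : Fin n → ℤ) :
    AEStronglyMeasurable (F.laguerreFourier k p) volume := by
  refine AEMeasurable.aestronglyMeasurable ?_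
  have hsnd : Measure.QuasiMeasurePreserving (Prod.snd : Horiz n × Center r → Center r)
      volume volume := Measure.quasiMeasurePreserving_snd
  have hmu : ∀ j, AEMeasurable fun z : Horiz n × Center r => F.mu (dir z.2) j := fun j =>
    (F.aemeasurable_mu_dir j).comp_quasiMeasurePreserving hsnd
  have hb : ∀ i, AEMeasurable fun z : Horiz n × Center r => (F.basis z.2).repr z.1 i := by
    intro i
    simp only [OrthonormalBasis.repr_apply_apply]
    exact ((F.aemeasurable_basis i).comp_quasiMeasurePreserving hsnd).inner
      measurable_fst.aemeasurable
  refine Finset.aemeasurable_fun_prod _ fun j _ => ?_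
  have hz : AEMeasurable (fun z : Horiz n × Center r =>
      (√(F.mu (dir z.2) j) : ℂ) * F.coord z.2 z.1 j) := by
    refine (Complex.measurable_ofReal.comp_aemeasurable
      (Real.continuous_sqrt.measurable.comp_aemeasurable (hmu j))).mul ?_
    exact (Complex.measurable_ofReal.comp_aemeasurable (hb _)).add
      ((Complex.measurable_ofReal.comp_aemeasurable (hb _)).const_mul _)
  have ht : AEMeasurable fun z : Horiz n × Center r => ‖z.2‖ :=
    measurable_snd.norm.aemeasurable
  have hq := (measurable_planeLaguerre (k j) (p j)).comp_aemeasurable (hz.prodMk ht)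
  exact (Complex.measurable_ofReal.comp_aemeasurable (hmu j)).mul hq

lemma exists_laguerreFourier_le (k : Fin n → ℕ) (p : Fin n → ℤ) :
    ∃ (C : ℝ) (m : ℕ), ∀ z, ‖F.laguerreFourier k p z‖ ≤ C * (1 + ‖z‖) ^ m := by
  choose C hC h using fun j => exists_planeLaguerre_le (k j) (p j)
  refine ⟨∏ j, ‖B‖ * C j, n, fun z => ?_⟩
  rw [laguerreFourier, norm_prod]
  have hn : (1 + ‖z‖) ^ n = ∏ _j : Fin n, (1 + ‖z‖) := by simp
  rw [hn, ← Finset.prod_mul_distrib]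
  refine Finset.prod_le_prod (fun _ _ => norm_nonneg _) fun j _ => ?_
  rw [norm_mul, Complex.norm_real, Real.norm_eq_abs, mul_assoc]
  have h1 : |F.mu (dir z.2) j| ≤ ‖B‖ :=
    (F.abs_mu_le _ j).trans (mul_le_of_le_one_left (norm_nonneg B) (norm_dir_le _))
  have h2 : ‖z.2‖ ≤ 1 + ‖z‖ := (norm_snd_le z).trans (by linarith)
  refine mul_le_mul h1 ((h j _ _ (norm_nonneg _)).trans ?_) (norm_nonneg _) (norm_nonneg B)
  exact mul_le_mul_of_nonneg_left h2 (hC j)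

/-- The exponential Laguerre distribution `𝓛_k^{(p)}` on `ℝ^{2n} × ℝ^r`: the tempered distribution
with partial Fourier transform `laguerreFourier k p`. -/
def laguerreDistribution (k : Fin n → ℕ) (p : Fin n → ℤ) : 𝓢'(Horiz n × Center r, ℂ) :=
  ofPartialFourier volume (F.laguerreFourier k p) (F.aestronglyMeasurable_laguerreFourier k p)
    (F.exists_laguerreFourier_le k p)

theorem laguerreDistribution_apply (k : Fin n → ℕ) (p : Fin n → ℤ)
    (φ : 𝓢(Horiz n × Center r, ℂ)) :
    F.laguerreDistribution k p φ = ∫ z, F.laguerreFourier k p z * invPartialFourier φ z :=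
  rfl

end NormalizingFrame

/-- The Schwartz function `v ↦ f (w · v⁻¹)`. -/
def translateInv (B : Horiz n →L[ℝ] Horiz n →L[ℝ] Center r) (f : 𝓢(Horiz n × Center r, ℂ))
    (w : Horiz n × Center r) : 𝓢(Horiz n × Center r, ℂ) :=
  SchwartzMap.compCLM ℂ (g := fun v => gmul B w (ginv v))
    (by
      have h : (fun v : Horiz n × Center r => gmul B w (ginv v)) = fun v => w -
          (v.1, v.2 + (2 : ℝ) • B w.1 v.1) := by
        funext v
        ext i <;> simp [gmul, ginv, sub_eq_add_neg]
        ring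
      have h2 : (fun v : Horiz n × Center r => (v.1, v.2 + (2 : ℝ) • B w.1 v.1)) =
          ((ContinuousLinearMap.fst ℝ (Horiz n) (Center r)).prod
            (ContinuousLinearMap.snd ℝ (Horiz n) (Center r) +
              (2 : ℝ) • (B w.1).comp (ContinuousLinearMap.fst ℝ (Horiz n) (Center r)))) := by
        funext v
        simp
      rw [h]
      exact (Function.HasTemperateGrowth.const w).sub
        (h2 ▸ ContinuousLinearMap.hasTemperateGrowth _))
    ⟨1, (1 + 2 * ‖B w.1‖) * (1 + ‖w‖), fun v => by
      set g := gmul B w (ginv v) with hg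
      have h1 : v.1 = w.1 - g.1 := by simp [hg, gmul, ginv]
      have h2 : v.2 = w.2 - g.2 - (2 : ℝ) • B w.1 v.1 := by
        simp only [hg, gmul, ginv, map_neg, smul_neg]
        abel
      have e1 : ‖v.1‖ ≤ ‖w‖ + ‖g‖ := by
        rw [h1]
        exact (norm_sub_le _ _).trans (add_le_add (norm_fst_le _) (norm_fst_le _))
      have e2 : ‖v.2‖ ≤ ‖w‖ + ‖g‖ + 2 * (‖B w.1‖ * ‖v.1‖) := by
        rw [h2]
        refine (norm_sub_le _ _).trans (add_le_add ((norm_sub_le _ _).trans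
          (add_le_add (norm_snd_le _) (norm_snd_le _))) ?_)
        rw [norm_smul, Real.norm_of_nonneg (by norm_num)]
        gcongr
        exact (B w.1).le_opNorm _
      have e3 : ‖v‖ ≤ (1 + 2 * ‖B w.1‖) * (‖w‖ + ‖g‖) := by
        have hb := norm_nonneg (B w.1)
        have hs : 0 ≤ ‖w‖ + ‖g‖ := by positivity
        rw [Prod.norm_def]
        refine max_le ?_ ?_
        · nlinarith [mul_nonneg hb hs]
        · nlinarith [mul_le_mul_of_nonneg_left e1 hb]
      refine e3.trans ?_
      rw [pow_one, mul_assoc]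
      have hw := norm_nonneg w
      have hgn := norm_nonneg g
      gcongr
      nlinarith⟩ f

@[simp] lemma translateInv_apply (f : 𝓢(Horiz n × Center r, ℂ)) (w v : Horiz n × Center r) :
    translateInv B f w v = f (gmul B w (ginv v)) := rfl

/-- The group convolution `f * u` of a Schwartz function `f` and a tempered distribution `u`:
`(f * u)(w) = ⟨u, f(w · (-)⁻¹)⟩`. -/
def convDistribution (B : Horiz n →L[ℝ] Horiz n →L[ℝ] Center r) (f : 𝓢(Horiz n × Center r, ℂ))
    (u : 𝓢'(Horiz n × Center r, ℂ)) (w : Horiz n × Center r) : ℂ :=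
  u (translateInv B f w)

end Group

end

end StepTwo

/-!
The proof passes to the Fourier transform in the central variable. For a function `g` of polynomial
growth, the convolution of `f` with the distribution whose partial Fourier transform is `g` is,
at `(x, t)`, the inverse Fourier transform at `t` of the twisted convolution
`ξ ↦ ∫ g(y, 2πξ) e^{-4πi⟨ξ, B(x, y)⟩} f̃(x - y, ξ) dy`, where `f̃` is the partial Fourier transform
of `f` (`integral_mul_invPartialFourier_translateInv`).

*Boundedness on `L²`.* The twist has modulus one, so by Young's inequality twisted convolution with
`g(·, τ)` is bounded on `L²(ℝ^{2n})` by `‖g(·, τ)‖₁`; Plancherel's theorem in the center then bounds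
the whole operator as soon as these norms are bounded uniformly in `τ`
(`lintegral_enorm_sq_fourierInv_twistedConv_le`). For the Laguerre kernels they are: with
`λ_j = μ_j(τ) > 0`, which is where non-degeneracy enters, the kernel is at most a constant times the
Gaussian probability density with parameters `λ_j / 2`, because Laguerre functions decay like
`e^{-σ/4}` (`exists_norm_laguerreFourier_le`). Density of Schwartz functions in `L²` gives the
unique extension.

*Abel summation.* The generating function of the Laguerre polynomials and Cauchy's estimate give
`|L_k(σ)| e^{-σ/2} ρ^k ≤ (1 - ρ)⁻¹` for every `0 < ρ < 1`, uniformly in `σ`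
(`abs_laguerrePoly_mul_exp_mul_pow_le`). Hence the series converges absolutely and may be summed
under the integral (`hasSum_convDistribution`). The summed kernel is
`(2 / (1 + R))^n` times the Gaussian probability density with parameters `(1 + R) / (1 - R) · λ_j`
(`abelKernel_eq_planeGaussian`), an approximate identity on `ℝ^{2n}` as `R → 1`. So the twisted
convolutions converge to `f̃(x, ξ)`, dominated by `2^n sup_y |f̃(y, ξ)|`, and Fourier inversion in
the center yields `f(x, t)` (`tendsto_integral_abelKernel`).
-/

namespace StepTwo

/-! ### Laguerre polynomials -/

/-- Cauchy's estimate for the coefficients of a power series. -/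
lemma norm_coeff_mul_pow_le_of_hasSum {a : ℕ → ℂ} {F : ℂ → ℂ}
    (h : ∀ z : ℂ, ‖z‖ < 1 → HasSum (fun k => a k * z ^ k) (F z)) {ρ M : ℝ} (hρ : 0 < ρ)
    (hρ1 : ρ < 1) (hM : ∀ z : ℂ, ‖z‖ = ρ → ‖F z‖ ≤ M) (k : ℕ) : ‖a k‖ * ρ ^ k ≤ M := by
  have hps : HasFPowerSeriesOnBall F (FormalMultilinearSeries.ofScalars ℂ a) 0 1 := by
    refine ⟨?_, one_pos, fun {y} hy => ?_⟩
    · refine ENNReal.le_of_forall_nnreal_lt fun r hr => ?_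
      refine FormalMultilinearSeries.le_radius_of_summable _ ?_
      have hr' : ‖((r : ℝ) : ℂ)‖ < 1 := by
        simpa using hr
      refine (h _ hr').summable.norm.congr fun n => ?_
      simp
    · have hy' : ‖y‖ < 1 := by
        simpa [Metric.mem_eball, edist_zero_right, ← ofReal_norm] using hy
      simpa [FormalMultilinearSeries.ofScalars_apply_eq, mul_comm] using h y hy'
  have hdiff : DifferentiableOn ℂ F (Metric.ball 0 1) := by
    have := hps.differentiableOn
    rwa [show (1 : ENNReal) = ENNReal.ofReal 1 by simp, Metric.eball_ofReal] at this
  have hcl : DiffContOnCl ℂ F (Metric.ball 0 ρ) :=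
    (hdiff.mono (Metric.closedBall_subset_ball hρ1)).diffContOnCl_ball subset_rfl
  have hc := Complex.norm_iteratedDeriv_le_of_forall_mem_sphere_norm_le k hρ hcl
    (fun z hz => hM z (by simpa using hz))
  have heq := hps.analyticAt.hasFPowerSeriesAt.eq_formalMultilinearSeries hps.hasFPowerSeriesAt
  have hk := congrFun (FormalMultilinearSeries.ofScalars_series_injective ℂ ℂ heq) k
  have hfac : (0 : ℝ) < k.factorial := by positivity
  rw [← hk, norm_div, Complex.norm_natCast, div_mul_eq_mul_div, div_le_iff₀ hfac, mul_comm M]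
  rwa [le_div_iff₀ (by positivity)] at hc

lemma hasSum_choose_mul_pow {𝕜 : Type*} [RCLike 𝕜] {z : 𝕜} (hz : ‖z‖ < 1) (m : ℕ) :
    HasSum (fun k : ℕ => (k.choose m : 𝕜) * z ^ k) (z ^ m / (1 - z) ^ (m + 1)) := by
  have h := (hasSum_choose_mul_geometric_of_norm_lt_one m hz).mul_left (z ^ m)
  rw [← hasSum_nat_add_iff' m, Finset.sum_eq_zero, sub_zero]
  · convert! h using 1
    · funext n; ring
    · ring
  · intro i hi
    rw [Nat.choose_eq_zero_of_lt (Finset.mem_range.1 hi)]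
    simp

lemma hasSum_pow_div_mul_pow_div_factorial {𝕜 : Type*} [RCLike 𝕜] (s : 𝕜) {w : 𝕜}
    (hw : 1 - w ≠ 0) :
    HasSum (fun m : ℕ => w ^ m / (1 - w) ^ (m + 1) * (s ^ m / m.factorial))
      ((1 - w)⁻¹ * NormedSpace.exp (s * w / (1 - w))) := by
  convert! (NormedSpace.expSeries_div_hasSum_exp (s * w / (1 - w))).mul_left (1 - w)⁻¹ using 1
  funext m
  rw [div_pow, mul_pow, pow_succ]
  field_simp

/-- The generating function of the Laguerre polynomials. -/
lemma hasSum_laguerrePoly_mul_pow (σ : ℝ) {z : ℂ} (hz : ‖z‖ < 1) :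
    HasSum (fun k : ℕ => (laguerrePoly k 0 σ : ℂ) * z ^ k)
      ((1 - z)⁻¹ * Complex.exp (-σ * z / (1 - z))) := by
  set a : ℕ × ℕ → ℂ := fun q => (q.2.choose q.1 : ℂ) * z ^ q.2 * ((-σ) ^ q.1 / q.1.factorial)
    with ha
  have hz1 : (1 : ℂ) - z ≠ 0 := by
    intro h
    rw [← sub_eq_zero.1 h] at hz
    simp at hz
  have hn : ∀ m : ℕ, HasSum (fun k => ‖a (m, k)‖)
      ((‖z‖ ^ m / (1 - ‖z‖) ^ (m + 1)) * (|σ| ^ m / m.factorial)) := by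
    intro m
    have h := (hasSum_choose_mul_pow (z := ‖z‖) (by simpa using hz) m).mul_right
      (|σ| ^ m / (m.factorial : ℝ))
    have he : ∀ k, ‖a (m, k)‖ = (k.choose m : ℝ) * ‖z‖ ^ k * (|σ| ^ m / (m.factorial : ℝ)) := by
      intro k
      simp [ha]
    simp only [he]
    exact h
  have hsum : Summable a := by
    refine Summable.of_norm ((summable_prod_of_nonneg fun q => norm_nonneg (a q)).2
      ⟨fun m => (hn m).summable, ?_⟩)
    simp only [(hn _).tsum_eq]
    exact (hasSum_pow_div_mul_pow_div_factorial |σ| (sub_pos.2 hz).ne').summable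
  have hfib := fun m => (hasSum_choose_mul_pow hz m).mul_right ((-σ : ℂ) ^ m / m.factorial)
  have htot : HasSum a ((1 - z)⁻¹ * Complex.exp (-σ * z / (1 - z))) := by
    have h1 := hsum.hasSum.prod_fiberwise hfib
    rw [Complex.exp_eq_exp_ℂ, ← h1.unique (hasSum_pow_div_mul_pow_div_factorial (-σ : ℂ) hz1)]
    exact hsum.hasSum
  have hswap := (Equiv.prodComm ℕ ℕ).hasSum_iff.2 htot
  refine hswap.prod_fiberwise fun k => ?_
  have hfin : ∀ m ∉ Finset.range (k + 1), (a ∘ Equiv.prodComm ℕ ℕ) (k, m) = 0 := by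
    intro m hm
    have : k < m := by simpa using hm
    simp [ha, Nat.choose_eq_zero_of_lt this]
  have hfs : HasSum (fun m => (a ∘ Equiv.prodComm ℕ ℕ) (k, m)) _ :=
    hasSum_sum_of_ne_finset_zero hfin
  convert! hfs using 1
  simp only [laguerrePoly, ha, Complex.ofReal_sum, Finset.sum_mul, Function.comp,
    Equiv.prodComm_apply, Prod.swap]
  refine Finset.sum_congr rfl fun m hm => ?_
  rw [add_zero, Nat.choose_symm (by simpa [Nat.lt_succ_iff] using hm)]
  push_cast
  ring

/-- Subexponential growth in `k` of the Laguerre functions, uniformly in `σ`: Cauchy's estimate on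
the circle of radius `ρ`, where `|exp (-σ z / (1 - z))| e^{-σ/2} ≤ 1`. -/
lemma abs_laguerrePoly_mul_exp_mul_pow_le (k : ℕ) {σ ρ : ℝ} (hσ : 0 ≤ σ) (hρ : 0 < ρ)
    (hρ1 : ρ < 1) :
    |laguerrePoly k 0 σ| * Real.exp (-σ / 2) * ρ ^ k ≤ (1 - ρ)⁻¹ := by
  have h := norm_coeff_mul_pow_le_of_hasSum (fun z hz => hasSum_laguerrePoly_mul_pow σ hz) hρ hρ1
    (M := (1 - ρ)⁻¹ * Real.exp (σ / 2)) (fun z hz => ?_) k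
  · rw [Complex.norm_real, Real.norm_eq_abs] at h
    calc |laguerrePoly k 0 σ| * Real.exp (-σ / 2) * ρ ^ k
        = (|laguerrePoly k 0 σ| * ρ ^ k) * Real.exp (-σ / 2) := by ring
      _ ≤ (1 - ρ)⁻¹ * Real.exp (σ / 2) * Real.exp (-σ / 2) := by gcongr
      _ = _ := by
        rw [mul_assoc, ← Real.exp_add, neg_div, add_neg_cancel, Real.exp_zero, mul_one]
  · have hz1 : 1 - ρ ≤ ‖1 - z‖ := by
      have := norm_sub_norm_le (1 : ℂ) z
      rwa [norm_one, hz] at this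
    have hpos : 0 < ‖1 - z‖ := by linarith
    have hne : (1 : ℂ) - z ≠ 0 := norm_pos_iff.1 hpos
    rw [norm_mul, norm_inv, Complex.norm_exp]
    refine mul_le_mul (inv_anti₀ (by linarith) hz1) (Real.exp_le_exp.2 ?_) (Real.exp_pos _).le
      (inv_nonneg.2 (by linarith))
    · have hre : (-(σ : ℂ) * z / (1 - z)).re =
          σ / 2 - σ / 2 * ((1 - ‖z‖ ^ 2) / ‖1 - z‖ ^ 2) := by
        have e : -(σ : ℂ) * z / (1 - z) = ((σ / 2 : ℝ) : ℂ) -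
            ((σ / 2 : ℝ) : ℂ) * ((1 + z) / (1 - z)) := by
          push_cast
          field_simp
          ring
        have e2 : ((1 + z) / (1 - z)).re = (1 - ‖z‖ ^ 2) / ‖1 - z‖ ^ 2 := by
          rw [Complex.div_re, ← Complex.normSq_eq_norm_sq, ← Complex.normSq_eq_norm_sq,
            Complex.normSq_apply z]
          simp
          ring
        rw [e, Complex.sub_re, Complex.re_ofReal_mul, e2, Complex.ofReal_re]
      rw [hre]
      have : 0 ≤ (1 - ‖z‖ ^ 2) / ‖1 - z‖ ^ 2 := by
        rw [hz]
        have : ρ ^ 2 ≤ 1 := pow_le_one₀ hρ.le hρ1.le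
        exact div_nonneg (by linarith) (by positivity)
      have := mul_nonneg (by positivity : (0 : ℝ) ≤ σ / 2) this
      linarith

/-- Laguerre functions decay exponentially. -/
lemma exists_abs_laguerreFun_le_mul_exp (k p : ℕ) : ∃ C : ℝ, 0 ≤ C ∧ ∀ σ : ℝ, 0 ≤ σ →
    |laguerreFun k p σ| ≤ C * Real.exp (-σ / 4) := by
  choose D hD0 hD using exists_pow_mul_exp_le
  set c := √(Real.Gamma (k + 1) / Real.Gamma (k + p + 1)) with hc
  have hc0 : 0 ≤ c := Real.sqrt_nonneg _
  set b : ℕ → ℝ := fun m => ((k + p).choose (k - m) : ℝ) / (m.factorial : ℝ) with hb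
  have hb0 : ∀ m, 0 ≤ b m := fun m => by positivity
  refine ⟨c * ∑ m ∈ Finset.range (k + 1), b m * (2 ^ m * D m + 2 ^ (m + p) * D (m + p)),
    mul_nonneg hc0 (Finset.sum_nonneg fun m _ => mul_nonneg (hb0 m)
      (add_nonneg (mul_nonneg (by positivity) (hD0 _)) (mul_nonneg (by positivity) (hD0 _)))),
    fun σ hσ => ?_⟩
  have hpow : σ ^ ((p : ℝ) / 2) ≤ 1 + σ ^ p := by
    rcases le_total σ 1 with h | h
    · have := Real.rpow_le_one hσ h (z := (p : ℝ) / 2) (by positivity)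
      have : 0 ≤ σ ^ p := by positivity
      linarith
    · have : σ ^ ((p : ℝ) / 2) ≤ σ ^ (p : ℝ) := Real.rpow_le_rpow_of_exponent_le h
        (by have : (0 : ℝ) ≤ p := by positivity
            linarith)
      rw [Real.rpow_natCast] at this
      linarith
  have hpoly : |laguerrePoly k p σ| ≤ ∑ m ∈ Finset.range (k + 1), b m * σ ^ m := by
    refine (Finset.abs_sum_le_sum_abs _ _).trans (Finset.sum_le_sum fun m _ => le_of_eq ?_)
    rw [abs_div, abs_mul, abs_pow, abs_neg, abs_of_nonneg hσ, Nat.abs_cast, Nat.abs_cast]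
    ring
  have hDσ : ∀ m, σ ^ m * Real.exp (-σ / 4) ≤ 2 ^ m * D m := fun m => by
    have := hD m (σ / 2) (by positivity)
    rw [div_pow, show -(σ / 2) / 2 = -σ / 4 by ring, div_mul_eq_mul_div,
      div_le_iff₀ (by positivity)] at this
    linarith
  have hr : 0 ≤ σ ^ ((p : ℝ) / 2) := Real.rpow_nonneg hσ _
  have hexp : Real.exp (-σ / 2) = Real.exp (-σ / 4) * Real.exp (-σ / 4) := by
    rw [← Real.exp_add]; ring_nf
  rw [laguerreFun, abs_mul, abs_mul, abs_mul, abs_of_nonneg hc0, abs_of_nonneg hr,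
    abs_of_nonneg (Real.exp_pos _).le, hexp, ← mul_assoc]
  refine mul_le_mul_of_nonneg_right ?_ (Real.exp_pos _).le
  calc c * |laguerrePoly k p σ| * σ ^ ((p : ℝ) / 2) * Real.exp (-σ / 4)
      ≤ c * (∑ m ∈ Finset.range (k + 1), b m * σ ^ m) * (1 + σ ^ p) * Real.exp (-σ / 4) := by
        gcongr
    _ = c * ∑ m ∈ Finset.range (k + 1), b m *
        (σ ^ m * Real.exp (-σ / 4) + σ ^ (m + p) * Real.exp (-σ / 4)) := by
        rw [mul_assoc c, mul_assoc c, Finset.sum_mul, Finset.sum_mul]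
        congr 1
        refine Finset.sum_congr rfl fun m _ => ?_
        ring
    _ ≤ _ := by
        refine mul_le_mul_of_nonneg_left (Finset.sum_le_sum fun m _ =>
          mul_le_mul_of_nonneg_left (add_le_add (hDσ _) (hDσ _)) (hb0 m)) hc0

lemma norm_planeLaguerre (k : ℕ) (p : ℤ) (z : ℂ) {t : ℝ} (ht : 0 ≤ t) :
    ‖planeLaguerre k p z t‖ ≤ 2 * t / Real.pi * |laguerreFun k p.natAbs (2 * t * ‖z‖ ^ 2)| := by
  have he : ‖Complex.exp (Complex.I * p * Complex.arg z)‖ = 1 := by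
    have : Complex.I * p * Complex.arg z = ((p * Complex.arg z : ℝ) : ℂ) * Complex.I := by
      push_cast; ring
    rw [this, Complex.norm_exp_ofReal_mul_I]
  rw [planeLaguerre, norm_mul, he, mul_one, Complex.norm_real, norm_mul, norm_mul]
  have hs : ‖(SignType.sign p : ℝ) ^ p‖ ≤ 1 := by
    rw [norm_zpow]
    rcases lt_trichotomy p 0 with hp | hp | hp
    · simp [sign_neg hp]
    · simp [hp]
    · simp [sign_pos hp]
  rw [Real.norm_of_nonneg (by positivity), Real.norm_eq_abs (laguerreFun _ _ _)]
  refine mul_le_mul_of_nonneg_right (mul_le_of_le_one_right (by positivity) hs) (abs_nonneg _)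

lemma planeLaguerre_zero (k : ℕ) (z : ℂ) (t : ℝ) :
    planeLaguerre k 0 z t = ((2 * t / Real.pi * (laguerrePoly k 0 (2 * t * ‖z‖ ^ 2) *
      Real.exp (-(t * ‖z‖ ^ 2))) : ℝ) : ℂ) := by
  have hG : Real.Gamma ((k : ℝ) + 1) ≠ 0 := (Real.Gamma_pos_of_pos (by positivity)).ne'
  have he : -(2 * t * ‖z‖ ^ 2) / 2 = -(t * ‖z‖ ^ 2) := by ring
  simp [planeLaguerre, laguerreFun, div_self hG, he]

lemma norm_planeLaguerre_zero_mul_pow_le (k : ℕ) (z : ℂ) {t ρ : ℝ} (ht : 0 ≤ t) (hρ : 0 < ρ)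
    (hρ1 : ρ < 1) : ‖planeLaguerre k 0 z t‖ * ρ ^ k ≤ 2 * t / Real.pi * (1 - ρ)⁻¹ := by
  have h := abs_laguerrePoly_mul_exp_mul_pow_le k (σ := 2 * t * ‖z‖ ^ 2) (by positivity) hρ hρ1
  rw [planeLaguerre_zero, Complex.norm_real, norm_mul, Real.norm_of_nonneg (by positivity),
    norm_mul, Real.norm_eq_abs, Real.norm_of_nonneg (Real.exp_pos _).le, mul_assoc]
  rw [show -(2 * t * ‖z‖ ^ 2) / 2 = -(t * ‖z‖ ^ 2) by ring] at h
  gcongr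

/-- The Abel sums of the Laguerre functions of the plane are Gaussians. -/
lemma hasSum_planeLaguerre_zero (z : ℂ) (t : ℝ) {R : ℝ} (hR0 : 0 ≤ R) (hR : R < 1) :
    HasSum (fun k => planeLaguerre k 0 z t * (R : ℂ) ^ k)
      ((2 * t / Real.pi * ((1 - R)⁻¹ * Real.exp (-((1 + R) / (1 - R) * (t * ‖z‖ ^ 2)))) : ℝ) : ℂ)
    := by
  have h := (hasSum_laguerrePoly_mul_pow (2 * t * ‖z‖ ^ 2) (z := (R : ℂ)) (by
    rwa [Complex.norm_real, Real.norm_of_nonneg hR0])).mul_left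
      ((2 * t / Real.pi * Real.exp (-(t * ‖z‖ ^ 2)) : ℝ) : ℂ)
  convert! h using 1
  · funext k
    rw [planeLaguerre_zero]
    push_cast
    ring
  · have h1 : 1 - R ≠ 0 := by linarith
    have : -((1 + R) / (1 - R) * (t * ‖z‖ ^ 2)) =
        -(t * ‖z‖ ^ 2) + -(2 * t * ‖z‖ ^ 2) * R / (1 - R) := by
      field_simp; ring
    rw [this, Real.exp_add]
    push_cast
    ring

/-! ### Plancherel's theorem and the partial Fourier transform -/

lemma eLpNorm_two_sq {α : Type*} [MeasurableSpace α] (μ : Measure α) (u : α → ℂ) :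
    eLpNorm u 2 μ ^ 2 = ∫⁻ x, ‖u x‖ₑ ^ 2 ∂μ := by
  have := eLpNorm_nnreal_pow_eq_lintegral (f := u) (p := 2) (μ := μ) two_ne_zero
  simpa [ENNReal.rpow_ofNat] using this

lemma eLpNorm_two_le_of_lintegral_sq_le {α : Type*} [MeasurableSpace α] {μ : Measure α}
    {u v : α → ℂ} {c : ENNReal} (h : ∫⁻ x, ‖u x‖ₑ ^ 2 ∂μ ≤ c ^ 2 * ∫⁻ x, ‖v x‖ₑ ^ 2 ∂μ) :
    eLpNorm u 2 μ ≤ c * eLpNorm v 2 μ := by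
  rwa [← eLpNorm_two_sq, ← eLpNorm_two_sq, ← mul_pow,
    ENNReal.pow_le_pow_left_iff two_ne_zero] at h

section Plancherel

variable {W : Type*} [NormedAddCommGroup W] [InnerProductSpace ℝ W] [FiniteDimensional ℝ W]
  [MeasurableSpace W] [BorelSpace W]

lemma integral_fourierInv_mul_eq {φ g : W → ℂ} (hφ : Integrable φ) (hg : Integrable g) :
    ∫ ξ, 𝓕⁻ φ ξ • g ξ = ∫ t, φ t • 𝓕⁻ g t := by
  have h := VectorFourier.integral_fourierIntegral_smul_eq_flip (L := -innerₗ W)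
    (μ := (volume : Measure W)) (ν := (volume : Measure W))
    Real.continuous_fourierChar (by simp only [LinearMap.neg_apply, innerₗ_apply_apply]; fun_prop) hφ hg
  have hf : (-innerₗ W).flip = -innerₗ W := by
    ext x y
    simp [real_inner_comm]
  rw [hf] at h
  exact h

/-- On `L¹ ∩ L²` the inverse Fourier transform of `L²` is given by the Fourier integral: both have
the same pairing with every test function. -/
lemma fourierInv_toLp_ae_eq {g : W → ℂ} (h1 : Integrable g) (h2 : MemLp g 2) :
    (𝓕⁻ h2.toLp : Lp ℂ 2 (volume : Measure W)) =ᵐ[volume] 𝓕⁻ g := by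
  have hcont : Continuous (𝓕⁻ g) :=
    VectorFourier.fourierIntegral_continuous Real.continuous_fourierChar
      (L := -innerₗ W) (by simp only [LinearMap.neg_apply, innerₗ_apply_apply]; fun_prop) h1
  refine ae_eq_of_integral_contDiff_smul_eq
    ((Lp.memLp _).locallyIntegrable (by norm_num)) hcont.locallyIntegrable fun φ hφ hφc => ?_
  have hφ' : ContDiff ℝ ∞ fun x => (φ x : ℂ) := Complex.ofRealCLM.contDiff.comp hφ
  have hφc' : HasCompactSupport fun x => (φ x : ℂ) :=
    hφc.comp_left (g := fun r : ℝ => (r : ℂ)) Complex.ofReal_zero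
  set ψ : 𝓢(W, ℂ) := hφc'.toSchwartzMap hφ' with hψ
  have hψa : ∀ x, ψ x = (φ x : ℂ) := fun x => rfl
  have e := congrArg (fun u : 𝓢'(W, ℂ) => u ψ) (Lp.fourierInv_toTemperedDistribution_eq h2.toLp)
  simp only [TemperedDistribution.fourierInv_apply, Lp.toTemperedDistribution_apply] at e
  have e2 : ∫ x, (𝓕⁻ ψ) x • (h2.toLp : W → ℂ) x = ∫ x, 𝓕⁻ (ψ : W → ℂ) x • g x := by
    refine integral_congr_ae ?_
    filter_upwards [h2.coeFn_toLp] with x hx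
    rw [hx, SchwartzMap.fourierInv_coe]
  rw [e2, integral_fourierInv_mul_eq ψ.integrable h1] at e
  simpa [hψa] using e.symm

/-- Plancherel's theorem for the Fourier integral of a function in `L¹ ∩ L²`. -/
lemma lintegral_enorm_sq_fourierInv {g : W → ℂ} (h1 : Integrable g) (h2 : MemLp g 2) :
    ∫⁻ t, ‖𝓕⁻ g t‖ₑ ^ 2 = ∫⁻ ξ, ‖g ξ‖ₑ ^ 2 := by
  have hn : ‖(𝓕⁻ h2.toLp : Lp ℂ 2 (volume : Measure W))‖ = ‖h2.toLp‖ :=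
    (Lp.fourierTransformₗᵢ W ℂ).symm.norm_map _
  have he : eLpNorm (𝓕⁻ g) 2 volume = eLpNorm g 2 volume := by
    rw [← eLpNorm_congr_ae (fourierInv_toLp_ae_eq h1 h2), ← eLpNorm_congr_ae h2.coeFn_toLp,
      ← Lp.enorm_def, ← Lp.enorm_def, ← ofReal_norm, ← ofReal_norm, hn]
  rw [← eLpNorm_two_sq, ← eLpNorm_two_sq, he]

end Plancherel

section Slices

variable {E W : Type*} [NormedAddCommGroup E] [NormedSpace ℝ E]
  [NormedAddCommGroup W] [InnerProductSpace ℝ W] [FiniteDimensional ℝ W]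
  [MeasurableSpace W] [BorelSpace W]

lemma continuous_fourier_slice (f : 𝓢(E × W, ℂ)) :
    Continuous fun q : E × W => 𝓕 (slice f q.1 : W → ℂ) q.2 := by
  set d := (volume : Measure W).integrablePower with hd
  have hint : Integrable (fun s : W => (1 + ‖s‖) ^ (-(d : ℝ))) :=
    Measure.integrable_pow_neg_integrablePower _
  simp only [Real.fourier_eq', slice_apply]
  set S := 2 ^ d * (Finset.Iic (d, 0)).sup (schwartzSeminormFamily ℂ (E × W) ℂ) f
  refine continuous_of_dominated (bound := fun s => S * (1 + ‖s‖) ^ (-(d : ℝ)))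
    (fun q => ?_) (fun q => Eventually.of_forall fun s => ?_) (hint.const_mul _)
    (Eventually.of_forall fun s => ?_)
  · have := f.continuous
    exact Continuous.aestronglyMeasurable (by fun_prop)
  · have h1 := SchwartzMap.one_add_le_sup_seminorm_apply (𝕜 := ℂ) (m := (d, 0)) (k := d)
      (n := 0) le_rfl le_rfl f (q.1, s)
    rw [norm_iteratedFDeriv_zero] at h1
    rw [norm_smul, Complex.norm_exp_ofReal_mul_I, one_mul, Real.rpow_neg (by positivity),
      Real.rpow_natCast, ← div_eq_mul_inv, le_div_iff₀ (by positivity), mul_comm]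
    refine le_trans ?_ h1
    gcongr
    exact norm_snd_le (q.1, s)
  · have := f.continuous
    fun_prop

lemma continuous_fourier_slice_sub (f : 𝓢(E × W, ℂ)) (x : E) (ξ : W) :
    Continuous fun y : E => 𝓕 (slice f (x - y) : W → ℂ) ξ :=
  (continuous_fourier_slice f).comp (f := fun y : E => (x - y, ξ)) (by fun_prop)

/-- The partial Fourier transform of a Schwartz function is dominated, uniformly in the horizontal
variable, by a bounded integrable function of the frequency. -/
lemma exists_fourier_slice_le (f : 𝓢(E × W, ℂ)) : ∃ D : W → ℝ, Integrable D ∧ (∃ C, ∀ ξ, D ξ ≤ C) ∧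
    ∀ y ξ, ‖𝓕 (slice f y : W → ℂ) ξ‖ ≤ D ξ := by
  set d := (volume : Measure W).integrablePower with hd
  have hint : Integrable (fun s : W => (1 + ‖s‖) ^ (-(d : ℝ))) :=
    Measure.integrable_pow_neg_integrablePower _
  obtain ⟨C, t, hC, h⟩ := exists_invPartialFourier_le' (E := E) (W := W) d
  set c : ℝ := (2 * Real.pi) ^ Module.finrank ℝ W with hc
  have hc0 : 0 < c := by positivity
  set S := c * (C * t.sup (schwartzSeminormFamily ℂ (E × W) ℂ) f) with hS
  have hS0 : 0 ≤ S := mul_nonneg hc0.le (mul_nonneg hC (apply_nonneg _ _))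
  refine ⟨fun s => S * (1 + ‖s‖) ^ (-(d : ℝ)), hint.const_mul _, ⟨S, fun ξ => ?_⟩, fun y ξ => ?_⟩
  · refine mul_le_of_le_one_right hS0 (Real.rpow_le_one_of_one_le_of_nonpos ?_ ?_)
    · linarith [norm_nonneg ξ]
    · simp
  · have h1 := h f (y, -(2 * Real.pi) • ξ)
    have hπ : (2 * Real.pi) ≠ 0 := by positivity
    rw [invPartialFourier_eq, smul_smul, neg_mul_neg, inv_mul_cancel₀ hπ, one_smul, ← hc, norm_mul,
      Complex.norm_real, Real.norm_of_nonneg (inv_nonneg.2 hc0.le)] at h1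
    have hle : ‖ξ‖ ≤ ‖(y, -(2 * Real.pi) • ξ)‖ := by
      refine le_trans ?_ (norm_snd_le _)
      rw [norm_smul, norm_neg, Real.norm_of_nonneg (by positivity)]
      nlinarith [Real.pi_gt_three, norm_nonneg ξ]
    change _ ≤ S * (1 + ‖ξ‖) ^ (-(d : ℝ))
    rw [Real.rpow_neg (by positivity), Real.rpow_natCast, ← div_eq_mul_inv,
      le_div_iff₀ (by positivity), hS, ← div_le_iff₀' hc0, div_eq_inv_mul]
    refine le_trans ?_ h1
    calc c⁻¹ * (‖𝓕 (slice f y : W → ℂ) ξ‖ * (1 + ‖ξ‖) ^ d)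
        = (1 + ‖ξ‖) ^ d * (c⁻¹ * ‖𝓕 (slice f y : W → ℂ) ξ‖) := by ring
      _ ≤ _ := by gcongr

end Slices

/-! ### Twisted convolution -/

section Twisted

variable {n r : ℕ} (B : Horiz n →L[ℝ] Horiz n →L[ℝ] Center r)

/-- Substituting `s ↦ t - s - 2B(x, y)` in the central integral turns the group translation into a
character. -/
lemma invPartialFourier_translateInv (f : 𝓢(Horiz n × Center r, ℂ)) (w z : Horiz n × Center r) :
    invPartialFourier (translateInv B f w) z = ((2 * Real.pi) ^ r : ℝ)⁻¹ *
      (Complex.exp (Complex.I * (inner ℝ z.2 (w.2 - (2 : ℝ) • B w.1 z.1) : ℝ)) *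
        𝓕 (slice f (w.1 - z.1) : Center r → ℂ) ((2 * Real.pi)⁻¹ • z.2)) := by
  set a := w.2 - (2 : ℝ) • B w.1 z.1 with ha
  have hg : ∀ s, translateInv B f w (z.1, s) = f (w.1 - z.1, a - s) := by
    intro s
    rw [translateInv_apply]
    congr 1
    simp only [gmul, ginv, ha, map_neg, smul_neg, sub_eq_add_neg, Prod.mk.injEq, true_and]
    abel
  unfold invPartialFourier
  rw [finrank_euclideanSpace_fin]
  congr 1
  set h : Center r → ℂ := fun s => Complex.exp (Complex.I * (inner ℝ z.2 (a - s) : ℝ)) *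
    f (w.1 - z.1, s) with hh
  have e1 : ∀ s, Complex.exp (Complex.I * (inner ℝ z.2 s : ℝ)) * translateInv B f w (z.1, s) =
      h (a - s) := by
    intro s
    rw [hg, hh]
    simp
  simp only [e1]
  rw [integral_sub_left_eq_self h, Real.fourier_eq', ← integral_const_mul]
  refine integral_congr_ae (Eventually.of_forall fun s => ?_)
  simp only [hh, slice_apply, smul_eq_mul]
  rw [← mul_assoc, ← Complex.exp_add]
  congr 2
  rw [inner_sub_right, inner_smul_right, real_inner_comm s]
  push_cast
  have : (Real.pi : ℂ) ≠ 0 := by exact_mod_cast Real.pi_ne_zero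
  field_simp
  ring

/-- The twisted convolution `f̃_ξ ×_ξ k(·, ξ)` at the point `x`, where `f̃_ξ` is the partial Fourier
transform of `f` in the central variable, at the frequency `ξ` (so that `τ = 2π ξ`). -/
noncomputable def twistedConv (k : Horiz n × Center r → ℂ) (f : 𝓢(Horiz n × Center r, ℂ))
    (x : Horiz n) (ξ : Center r) : ℂ :=
  ∫ y, k (y, ξ) * (Complex.exp (Complex.I * (-(4 * Real.pi * inner ℝ ξ (B x y)) : ℝ)) *
    𝓕 (slice f (x - y) : Center r → ℂ) ξ)

/-- The partial Fourier transform turns group convolution into twisted convolution. -/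
lemma integral_mul_invPartialFourier_translateInv {g : Horiz n × Center r → ℂ}
    (hgm : AEStronglyMeasurable g volume)
    (hg : ∃ (C : ℝ) (m : ℕ), ∀ z, ‖g z‖ ≤ C * (1 + ‖z‖) ^ m) (f : 𝓢(Horiz n × Center r, ℂ))
    (w : Horiz n × Center r) :
    ∫ z, g z * invPartialFourier (translateInv B f w) z =
      𝓕⁻ (twistedConv B (fun z => g (z.1, (2 * Real.pi) • z.2)) f w.1) w.2 := by
  have hπ : (2 * Real.pi) ≠ 0 := by positivity
  have hint := integrable_mul_invPartialFourier volume hgm hg (translateInv B f w)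
  rw [Measure.volume_eq_prod] at hint ⊢
  rw [integral_prod_symm _ hint]
  set H : Center r → ℂ := fun ξ => Complex.exp (Complex.I * (2 * Real.pi * inner ℝ ξ w.2 : ℝ)) *
    twistedConv B (fun z => g (z.1, (2 * Real.pi) • z.2)) f w.1 ξ with hH
  have e : ∀ τ : Center r, ∫ y, g (y, τ) * invPartialFourier (translateInv B f w) (y, τ) =
      ((2 * Real.pi) ^ r : ℝ)⁻¹ * H ((2 * Real.pi)⁻¹ • τ) := by
    intro τ
    rw [hH]
    simp only [twistedConv, smul_smul, mul_inv_cancel₀ hπ, one_smul]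
    rw [← integral_const_mul, ← integral_const_mul]
    refine integral_congr_ae (Eventually.of_forall fun y => ?_)
    simp only [invPartialFourier_translateInv]
    have e3 : Complex.exp (Complex.I * (inner ℝ τ (w.2 - (2 : ℝ) • B w.1 y) : ℝ)) =
        Complex.exp (Complex.I * (2 * Real.pi * inner ℝ ((2 * Real.pi)⁻¹ • τ) w.2 : ℝ)) *
        Complex.exp (Complex.I *
          (-(4 * Real.pi * inner ℝ ((2 * Real.pi)⁻¹ • τ) (B w.1 y)) : ℝ)) := by
      rw [← Complex.exp_add]
      congr 1
      rw [inner_sub_right, inner_smul_right, real_inner_smul_left, real_inner_smul_left]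
      push_cast
      have : (Real.pi : ℂ) ≠ 0 := by exact_mod_cast Real.pi_ne_zero
      field_simp
      ring
    rw [e3]
    push_cast
    ring
  simp only [e]
  rw [integral_const_mul, Measure.integral_comp_inv_smul_of_nonneg _ _ (by positivity),
    finrank_euclideanSpace_fin, Complex.real_smul, Complex.ofReal_inv, ← mul_assoc,
    inv_mul_cancel₀ (by exact_mod_cast pow_ne_zero r hπ), one_mul, Real.fourierInv_eq']
  refine integral_congr_ae (Eventually.of_forall fun ξ => ?_)
  simp only [hH, smul_eq_mul]
  congr 2
  push_cast
  ring

variable {B} {k : Horiz n × Center r → ℂ}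

lemma stronglyMeasurable_twistedConv (hk : StronglyMeasurable k) (f : 𝓢(Horiz n × Center r, ℂ)) :
    StronglyMeasurable fun q : Horiz n × Center r => twistedConv B k f q.1 q.2 := by
  have h1 : StronglyMeasurable fun p : (Horiz n × Center r) × Horiz n => k (p.2, p.1.2) :=
    hk.comp_measurable (by fun_prop)
  have h2 : Continuous fun p : (Horiz n × Center r) × Horiz n =>
      𝓕 (slice f (p.1.1 - p.2) : Center r → ℂ) p.1.2 :=
    (continuous_fourier_slice f).comp (f := fun p : (Horiz n × Center r) × Horiz n =>
      ((p.1.1 - p.2, p.1.2) : Horiz n × Center r)) (by fun_prop)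
  have h3 : Continuous fun p : (Horiz n × Center r) × Horiz n => B p.1.1 p.2 :=
    B.isBoundedBilinearMap.continuous.comp (g := fun q : Horiz n × Horiz n => B q.1 q.2)
      (f := fun p : (Horiz n × Center r) × Horiz n => (p.1.1, p.2)) (by fun_prop)
  have h4 : Continuous fun p : (Horiz n × Center r) × Horiz n =>
      Complex.exp (Complex.I * (-(4 * Real.pi * inner ℝ p.1.2 (B p.1.1 p.2)) : ℝ)) *
        𝓕 (slice f (p.1.1 - p.2) : Center r → ℂ) p.1.2 := by fun_prop
  exact (h1.mul h4.stronglyMeasurable).integral_prod_right'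

lemma norm_twistedConv_integrand (f : 𝓢(Horiz n × Center r, ℂ)) (x y : Horiz n) (ξ : Center r) :
    ‖k (y, ξ) * (Complex.exp (Complex.I * (-(4 * Real.pi * inner ℝ ξ (B x y)) : ℝ)) *
      𝓕 (slice f (x - y) : Center r → ℂ) ξ)‖ₑ =
      ‖k (y, ξ)‖ₑ * ‖𝓕 (slice f (x - y) : Center r → ℂ) ξ‖ₑ := by
  rw [enorm_mul, enorm_mul, mul_comm Complex.I, ← ofReal_norm (Complex.exp _),
    Complex.norm_exp_ofReal_mul_I, ENNReal.ofReal_one, one_mul]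

lemma enorm_twistedConv_le (f : 𝓢(Horiz n × Center r, ℂ)) (x : Horiz n) (ξ : Center r) :
    ‖twistedConv B k f x ξ‖ₑ ≤
      ∫⁻ y, ‖k (y, ξ)‖ₑ * ‖𝓕 (slice f (x - y) : Center r → ℂ) ξ‖ₑ := by
  refine (enorm_integral_le_lintegral_enorm _).trans_eq ?_
  simp only [norm_twistedConv_integrand]

lemma norm_twistedConv_le {A D : ℝ} (hA : 0 ≤ A) {f : 𝓢(Horiz n × Center r, ℂ)} {ξ : Center r}
    (hk : ∫⁻ y, ‖k (y, ξ)‖ₑ ≤ ENNReal.ofReal A)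
    (hD : ∀ y, ‖𝓕 (slice f y : Center r → ℂ) ξ‖ ≤ D) (x : Horiz n) :
    ‖twistedConv B k f x ξ‖ ≤ A * D := by
  have hD0 : 0 ≤ D := (norm_nonneg _).trans (hD 0)
  rw [← ENNReal.ofReal_le_ofReal_iff (mul_nonneg hA hD0), ofReal_norm, ENNReal.ofReal_mul hA]
  refine (enorm_twistedConv_le f x ξ).trans ?_
  refine le_trans (lintegral_mono fun y => ?_)
    ((lintegral_mul_const' (ENNReal.ofReal D) _ ENNReal.ofReal_ne_top).trans_le
      (mul_le_mul_left hk _))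
  gcongr
  rw [← ofReal_norm]
  exact ENNReal.ofReal_le_ofReal (hD _)

/-- Young's inequality `‖u * v‖₂ ≤ ‖u‖₁ ‖v‖₂` for nonnegative functions. -/
lemma lintegral_sq_lintegral_mul_sub_le {u v : Horiz n → ENNReal} (hu : AEMeasurable u)
    (hv : Measurable v) :
    ∫⁻ x, (∫⁻ y, u y * v (x - y)) ^ 2 ≤ (∫⁻ y, u y) ^ 2 * ∫⁻ x, v x ^ 2 := by
  -- Cauchy-Schwarz for the splitting `u v = √u · (√u v)`
  have hcs : ∀ x, (∫⁻ y, u y * v (x - y)) ^ 2 ≤ (∫⁻ y, u y) * ∫⁻ y, u y * v (x - y) ^ 2 := by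
    intro x
    have hvx : Measurable fun y => v (x - y) := hv.comp (by fun_prop)
    have h := ENNReal.lintegral_mul_le_Lp_mul_Lq volume Real.HolderConjugate.two_two
      (f := fun y => u y ^ (1 / 2 : ℝ)) (g := fun y => u y ^ (1 / 2 : ℝ) * v (x - y))
      (hu.pow_const _) ((hu.pow_const _).mul hvx.aemeasurable)
    have hu2 : ∀ y, u y ^ (1 / 2 : ℝ) * u y ^ (1 / 2 : ℝ) = u y := fun y => by
      rw [← ENNReal.rpow_add_of_nonneg _ _ (by norm_num) (by norm_num)]; norm_num
    have hu3 : ∀ y, (u y ^ (1 / 2 : ℝ)) ^ (2 : ℝ) = u y := fun y => by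
      rw [← ENNReal.rpow_mul]; norm_num
    simp only [Pi.mul_apply, ← mul_assoc, hu2, ENNReal.mul_rpow_of_nonneg _ _ zero_le_two, hu3]
      at h
    calc (∫⁻ y, u y * v (x - y)) ^ 2
        ≤ ((∫⁻ y, u y) ^ (1 / 2 : ℝ) * (∫⁻ y, u y * v (x - y) ^ (2 : ℝ)) ^ (1 / 2 : ℝ)) ^ 2 := by
          gcongr
      _ = _ := by
          rw [mul_pow, ← ENNReal.rpow_mul_natCast, ← ENNReal.rpow_mul_natCast]
          norm_num
  have hm : Measurable fun p : Horiz n × Horiz n => v (p.1 - p.2) ^ 2 :=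
    (hv.comp (by fun_prop : Measurable fun p : Horiz n × Horiz n => p.1 - p.2)).pow_const 2
  calc ∫⁻ x, (∫⁻ y, u y * v (x - y)) ^ 2
      ≤ ∫⁻ x, (∫⁻ y, u y) * ∫⁻ y, u y * v (x - y) ^ 2 := lintegral_mono hcs
    _ = (∫⁻ y, u y) * ∫⁻ x, ∫⁻ y, u y * v (x - y) ^ 2 := by
        refine lintegral_const_mul'' _ ?_
        exact (AEMeasurable.lintegral_prod_right' (f := fun p : Horiz n × Horiz n =>
          u p.2 * v (p.1 - p.2) ^ 2) (hu.comp_snd.mul hm.aemeasurable))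
    _ = (∫⁻ y, u y) * ∫⁻ y, ∫⁻ x, u y * v (x - y) ^ 2 := by
        rw [lintegral_lintegral_swap]
        exact hu.comp_snd.mul hm.aemeasurable
    _ = (∫⁻ y, u y) * ∫⁻ y, u y * ∫⁻ x, v x ^ 2 := by
        congr 1
        refine lintegral_congr fun y => ?_
        have hvy : Measurable fun x => v (x - y) := hv.comp (by fun_prop)
        rw [lintegral_const_mul _ (hvy.pow_const 2),
          lintegral_sub_right_eq_self (fun x => v x ^ 2) y]
    _ = _ := by
        rw [lintegral_mul_const'' _ hu, ← mul_assoc, sq]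

lemma ae_ae_of_ae_horiz_center {P : Horiz n × Center r → Prop} (h : ∀ᵐ z, P z) :
    ∀ᵐ ξ, ∀ᵐ y, P (y, ξ) := by
  rw [Measure.volume_eq_prod] at h
  exact Measure.ae_ae_of_ae_prod (Measure.measurePreserving_swap.quasiMeasurePreserving.ae h)

/-- Kernels that agree almost everywhere have the same twisted convolutions at almost every
frequency, the exceptional set being independent of `x`. -/
lemma twistedConv_congr_ae {k' : Horiz n × Center r → ℂ} (h : k =ᵐ[volume] k')
    (f : 𝓢(Horiz n × Center r, ℂ)) :
    ∀ᵐ ξ, ∀ x, twistedConv B k f x ξ = twistedConv B k' f x ξ := by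
  filter_upwards [ae_ae_of_ae_horiz_center h] with ξ hξ x
  refine integral_congr_ae ?_
  filter_upwards [hξ] with y hy
  rw [hy]

lemma aestronglyMeasurable_twistedConv (hk : AEStronglyMeasurable k volume)
    (f : 𝓢(Horiz n × Center r, ℂ)) (x : Horiz n) :
    AEStronglyMeasurable (twistedConv B k f x) volume := by
  obtain ⟨k', hk', hkk⟩ := hk
  refine ⟨twistedConv B k' f x, ?_, (twistedConv_congr_ae hkk f).mono fun ξ h => h x⟩
  exact (stronglyMeasurable_twistedConv hk' f).comp_measurable (g := fun ξ => (x, ξ))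
    (by fun_prop)

variable {A : ℝ}

/-- A kernel whose slices are uniformly in `L¹` acts boundedly on `L²`. -/
lemma lintegral_enorm_sq_fourierInv_twistedConv_le (hk : AEStronglyMeasurable k volume)
    (hA : 0 ≤ A) (hkA : ∀ᵐ ξ, ∫⁻ y, ‖k (y, ξ)‖ₑ ≤ ENNReal.ofReal A)
    (f : 𝓢(Horiz n × Center r, ℂ)) :
    AEStronglyMeasurable (fun w : Horiz n × Center r => 𝓕⁻ (twistedConv B k f w.1) w.2) volume ∧
    ∫⁻ w : Horiz n × Center r, ‖𝓕⁻ (twistedConv B k f w.1) w.2‖ₑ ^ 2 ≤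
      ENNReal.ofReal A ^ 2 * ∫⁻ z, ‖f z‖ₑ ^ 2 := by
  -- a strongly measurable representative of `k` makes all functions below jointly measurable
  obtain ⟨k', hk', hkk⟩ := hk
  have hcongr := twistedConv_congr_ae (B := B) hkk f
  have hF : ∀ w : Horiz n × Center r,
      𝓕⁻ (twistedConv B k f w.1) w.2 = 𝓕⁻ (twistedConv B k' f w.1) w.2 := fun w =>
    Real.fourierInv_congr_ae (hcongr.mono fun ξ h => h w.1) w.2
  have hk'A : ∀ᵐ ξ, ∫⁻ y, ‖k' (y, ξ)‖ₑ ≤ ENNReal.ofReal A := by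
    filter_upwards [ae_ae_of_ae_horiz_center hkk, hkA] with ξ h1 h2
    refine le_trans (le_of_eq (lintegral_congr_ae ?_)) h2
    filter_upwards [h1] with y hy
    rw [hy]
  simp only [hF]
  set Q : Horiz n → Center r → ℂ := fun x ξ => twistedConv B k' f x ξ with hQ
  have hQm : StronglyMeasurable fun q : Horiz n × Center r => Q q.1 q.2 :=
    stronglyMeasurable_twistedConv hk' f
  have hFm : StronglyMeasurable fun w : Horiz n × Center r => 𝓕⁻ (Q w.1) w.2 := by
    simp only [Real.fourierInv_eq', smul_eq_mul]
    have h1 : StronglyMeasurable fun p : (Horiz n × Center r) × Center r => Q p.1.1 p.2 :=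
      hQm.comp_measurable (g := fun p : (Horiz n × Center r) × Center r => (p.1.1, p.2))
        (by fun_prop)
    have h2 : Continuous fun p : (Horiz n × Center r) × Center r =>
        Complex.exp ((2 * Real.pi * inner ℝ p.2 p.1.2 : ℝ) * Complex.I) := by fun_prop
    exact (h2.stronglyMeasurable.mul h1).integral_prod_right'
  refine ⟨hFm.aestronglyMeasurable, ?_⟩
  obtain ⟨D, hDi, ⟨C, hDC⟩, hD⟩ := exists_fourier_slice_le f
  have hD0 : ∀ ξ, 0 ≤ D ξ := fun ξ => (norm_nonneg _).trans (hD 0 ξ)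
  have hQle : ∀ x, ∀ᵐ ξ, ‖Q x ξ‖ ≤ A * D ξ := fun x => hk'A.mono fun ξ h =>
    norm_twistedConv_le hA h (fun y => hD y ξ) x
  have hQx : ∀ x, StronglyMeasurable (Q x) := fun x =>
    hQm.comp_measurable (g := fun ξ => (x, ξ)) (by fun_prop)
  have hQi : ∀ x, Integrable (Q x) := fun x =>
    (hDi.const_mul A).mono' (hQx x).aestronglyMeasurable (hQle x)
  have hQ2 : ∀ x, MemLp (Q x) 2 := fun x => by
    rw [memLp_two_iff_integrable_sq_norm (hQx x).aestronglyMeasurable]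
    refine ((hDi.const_mul (A ^ 2 * C))).mono' ((hQx x).norm.pow 2).aestronglyMeasurable ?_
    filter_upwards [hQle x] with ξ h
    rw [Real.norm_of_nonneg (by positivity)]
    calc ‖Q x ξ‖ ^ 2 ≤ (A * D ξ) ^ 2 := by gcongr
      _ = A ^ 2 * D ξ * D ξ := by ring
      _ ≤ A ^ 2 * C * D ξ := by
        gcongr
        · exact hD0 ξ
        · exact hDC ξ
  have hfm : Measurable fun q : Horiz n × Center r => 𝓕 (slice f q.1 : Center r → ℂ) q.2 :=
    (continuous_fourier_slice f).measurable
  have hPl : ∀ x, ∫⁻ ξ, ‖𝓕 (slice f x : Center r → ℂ) ξ‖ₑ ^ 2 = ∫⁻ s, ‖f (x, s)‖ₑ ^ 2 := by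
    intro x
    have h := lintegral_enorm_sq_fourierInv (𝓕 (slice f x)).integrable ((𝓕 (slice f x)).memLp 2)
    rw [← SchwartzMap.fourierInv_coe, FourierTransform.fourierInv_fourier_eq] at h
    rw [← SchwartzMap.fourier_coe, ← h]
    rfl
  have hsq : ∀ {u : Horiz n × Center r → ℂ}, Measurable u → Measurable fun q => ‖u q‖ₑ ^ 2 :=
    fun hu => hu.enorm.pow_const 2
  rw [Measure.volume_eq_prod, lintegral_prod _ (hsq hFm.measurable).aemeasurable,
    lintegral_prod _ (hsq f.continuous.measurable).aemeasurable]
  calc ∫⁻ x, ∫⁻ t, ‖𝓕⁻ (Q x) t‖ₑ ^ 2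
      = ∫⁻ x, ∫⁻ ξ, ‖Q x ξ‖ₑ ^ 2 :=
        lintegral_congr fun x => lintegral_enorm_sq_fourierInv (hQi x) (hQ2 x)
    _ = ∫⁻ ξ, ∫⁻ x, ‖Q x ξ‖ₑ ^ 2 := lintegral_lintegral_swap (hsq hQm.measurable).aemeasurable
    _ ≤ ∫⁻ ξ, ENNReal.ofReal A ^ 2 * ∫⁻ x, ‖𝓕 (slice f x : Center r → ℂ) ξ‖ₑ ^ 2 := by
        refine lintegral_mono_ae ?_
        filter_upwards [hk'A] with ξ hξ
        have hkξ : Measurable fun y => ‖k' (y, ξ)‖ₑ :=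
          (hk'.measurable.comp (by fun_prop : Measurable fun y : Horiz n => (y, ξ))).enorm
        have hfξ : Measurable fun x => ‖𝓕 (slice f x : Center r → ℂ) ξ‖ₑ :=
          (hfm.comp (by fun_prop : Measurable fun y : Horiz n => (y, ξ))).enorm
        calc ∫⁻ x, ‖Q x ξ‖ₑ ^ 2 ≤ ∫⁻ x, (∫⁻ y, ‖k' (y, ξ)‖ₑ *
              ‖𝓕 (slice f (x - y) : Center r → ℂ) ξ‖ₑ) ^ 2 := by
              refine lintegral_mono fun x => ?_
              gcongr
              exact enorm_twistedConv_le f x ξ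
          _ ≤ (∫⁻ y, ‖k' (y, ξ)‖ₑ) ^ 2 * ∫⁻ x, ‖𝓕 (slice f x : Center r → ℂ) ξ‖ₑ ^ 2 :=
              lintegral_sq_lintegral_mul_sub_le hkξ.aemeasurable hfξ
          _ ≤ _ := by gcongr
    _ = ENNReal.ofReal A ^ 2 * ∫⁻ ξ, ∫⁻ x, ‖𝓕 (slice f x : Center r → ℂ) ξ‖ₑ ^ 2 :=
        lintegral_const_mul' _ _ (by finiteness)
    _ = ENNReal.ofReal A ^ 2 * ∫⁻ x, ∫⁻ s, ‖f (x, s)‖ₑ ^ 2 := by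
        rw [lintegral_lintegral_swap (f := fun ξ x => ‖𝓕 (slice f x : Center r → ℂ) ξ‖ₑ ^ 2)
          ((hsq hfm).comp measurable_swap).aemeasurable]
        simp only [hPl]

end Twisted

/-! ### Gaussians and products of series -/

section Gauss

variable {n : ℕ} (e : OrthonormalBasis (Fin n × Fin 2) ℝ (Horiz n))

/-- The Gaussian density with parameters `lam j` in the coordinate planes of the orthonormal basis
`e`, normalized to have integral one. -/
noncomputable def planeGaussian (lam : Fin n → ℝ) (y : Horiz n) : ℝ :=
  ∏ j, lam j / Real.pi * Real.exp (-(lam j * (e.repr y (j, 0) ^ 2 + e.repr y (j, 1) ^ 2)))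

variable {e} {lam : Fin n → ℝ}

lemma planeGaussian_nonneg (h : ∀ j, 0 ≤ lam j) (y : Horiz n) : 0 ≤ planeGaussian e lam y :=
  Finset.prod_nonneg fun j _ => mul_nonneg (div_nonneg (h j) Real.pi_pos.le) (Real.exp_pos _).le

lemma planeGaussian_eq_prod (h : ∀ j, 0 < lam j) (y : Horiz n) :
    planeGaussian e lam y = ∏ i : Fin n × Fin 2,
      (√(lam i.1 / Real.pi) * Real.exp (-lam i.1 * WithLp.ofLp (e.repr y) i ^ 2)) := by
  rw [planeGaussian, Fintype.prod_prod_type]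
  refine Finset.prod_congr rfl fun j _ => ?_
  rw [Fin.prod_univ_two, mul_mul_mul_comm, ← Real.exp_add,
    Real.mul_self_sqrt (div_nonneg (h j).le Real.pi_pos.le)]
  congr 2
  ring

lemma measurePreserving_repr (e : OrthonormalBasis (Fin n × Fin 2) ℝ (Horiz n)) :
    MeasurePreserving (fun y : Horiz n => WithLp.ofLp (e.repr y)) :=
  (PiLp.volume_preserving_ofLp (Fin n × Fin 2)).comp e.repr.measurePreserving

lemma integrable_planeGaussian (h : ∀ j, 0 < lam j) : Integrable (planeGaussian e lam) := by
  have hp : Integrable (fun v : Fin n × Fin 2 → ℝ => ∏ i : Fin n × Fin 2,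
      (√(lam i.1 / Real.pi) * Real.exp (-lam i.1 * v i ^ 2))) :=
    Integrable.fintype_prod (f := fun (i : Fin n × Fin 2) (v : ℝ) =>
      √(lam i.1 / Real.pi) * Real.exp (-lam i.1 * v ^ 2))
      fun i => (integrable_exp_neg_mul_sq (h i.1)).const_mul _
  refine ((measurePreserving_repr e).integrable_comp_of_integrable hp).congr
    (Eventually.of_forall fun y => ?_)
  rw [planeGaussian_eq_prod h]
  rfl

lemma integral_planeGaussian (h : ∀ j, 0 < lam j) : ∫ y, planeGaussian e lam y = 1 := by
  have hemb : MeasurableEmbedding (fun y : Horiz n => WithLp.ofLp (e.repr y)) :=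
    (MeasurableEquiv.toLp 2 (Fin n × Fin 2 → ℝ)).symm.measurableEmbedding.comp
      e.repr.toHomeomorph.measurableEmbedding
  simp only [planeGaussian_eq_prod h]
  rw [(measurePreserving_repr e).integral_comp hemb (fun v : Fin n × Fin 2 → ℝ =>
    ∏ i : Fin n × Fin 2, (√(lam i.1 / Real.pi) * Real.exp (-lam i.1 * v i ^ 2))),
    integral_fintype_prod_volume_eq_prod (fun (i : Fin n × Fin 2) (v : ℝ) =>
      √(lam i.1 / Real.pi) * Real.exp (-lam i.1 * v ^ 2))]
  refine Finset.prod_eq_one fun i _ => ?_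
  have := h i.1
  rw [integral_const_mul, integral_gaussian, ← Real.sqrt_mul (by positivity)]
  rw [div_mul_div_cancel₀ Real.pi_ne_zero, div_self this.ne', Real.sqrt_one]

lemma lintegral_ofReal_mul_planeGaussian (h : ∀ j, 0 < lam j) {C : ℝ} (hC : 0 ≤ C) :
    ∫⁻ y, ENNReal.ofReal (C * planeGaussian e lam y) = ENNReal.ofReal C := by
  rw [← ofReal_integral_eq_lintegral_ofReal ((integrable_planeGaussian h).const_mul C)
    (Eventually.of_forall fun y => mul_nonneg hC (planeGaussian_nonneg (fun j => (h j).le) y)),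
    integral_const_mul, integral_planeGaussian h, mul_one]

lemma planeGaussian_mul {a : ℝ} (ha : 0 ≤ a) (y : Horiz n) :
    planeGaussian e (fun j => a * lam j) y = a ^ n * planeGaussian e lam (√a • y) := by
  have hn : a ^ n = ∏ _j : Fin n, a := by simp
  rw [planeGaussian, planeGaussian, hn, ← Finset.prod_mul_distrib]
  refine Finset.prod_congr rfl fun j _ => ?_
  simp only [map_smul, PiLp.smul_apply, smul_eq_mul, mul_pow, Real.sq_sqrt ha]
  rw [← mul_assoc, mul_div_assoc]
  congr 2
  ring

/-- Concentrating Gaussians are an approximate identity. -/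
lemma tendsto_integral_planeGaussian_mul (h : ∀ j, 0 < lam j) {φ : Horiz n → ℂ}
    (hφ : Continuous φ) {C : ℝ} (hC : ∀ y, ‖φ y‖ ≤ C) :
    Tendsto (fun a : ℝ => ∫ y, (planeGaussian e (fun j => a * lam j) y : ℂ) * φ y) atTop
      (𝓝 (φ 0)) := by
  -- rescaling by `√a` moves the dependence on `a` from the Gaussian to `φ`
  have heq : ∀ᶠ a : ℝ in atTop, ∫ u, (planeGaussian e lam u : ℂ) * φ ((√a)⁻¹ • u) =
      ∫ y, (planeGaussian e (fun j => a * lam j) y : ℂ) * φ y := by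
    filter_upwards [eventually_gt_atTop 0] with a ha
    have hs : 0 < √a := Real.sqrt_pos.2 ha
    have h1 := Measure.integral_comp_smul (volume : Measure (Horiz n))
      (fun u => (planeGaussian e lam u : ℂ) * φ ((√a)⁻¹ • u)) √a
    have hpow : √a ^ (2 * n) = a ^ n := by rw [pow_mul, Real.sq_sqrt ha.le]
    rw [finrank_euclideanSpace_fin, hpow, abs_of_pos (by positivity)] at h1
    simp only [smul_smul, inv_mul_cancel₀ hs.ne', one_smul] at h1
    simp only [planeGaussian_mul ha.le, Complex.ofReal_mul, mul_assoc]
    rw [integral_const_mul, h1, Complex.real_smul, ← mul_assoc, ← Complex.ofReal_mul,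
      mul_inv_cancel₀ (by positivity), Complex.ofReal_one, one_mul]
  refine Tendsto.congr' heq ?_
  have hlim : φ 0 = ∫ u, (planeGaussian e lam u : ℂ) * φ 0 := by
    rw [integral_mul_const, integral_complex_ofReal, integral_planeGaussian h, Complex.ofReal_one,
      one_mul]
  rw [hlim]
  have hG := integrable_planeGaussian (e := e) h
  refine tendsto_integral_filter_of_dominated_convergence (fun u => planeGaussian e lam u * C)
    (Eventually.of_forall fun a => ?_) (Eventually.of_forall fun a => Eventually.of_forall
      fun u => ?_) (hG.mul_const C) (Eventually.of_forall fun u => ?_)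
  · exact hG.ofReal.aestronglyMeasurable.mul (Continuous.aestronglyMeasurable (by fun_prop))
  · rw [norm_mul, Complex.norm_real, Real.norm_of_nonneg (planeGaussian_nonneg (fun j => (h j).le) u)]
    exact mul_le_mul_of_nonneg_left (hC _) (planeGaussian_nonneg (fun j => (h j).le) u)
  · refine Tendsto.const_mul _ ?_
    have h0 : Tendsto (fun a : ℝ => (√a)⁻¹ • u) atTop (𝓝 ((0 : ℝ) • u)) :=
      (tendsto_inv_atTop_zero.comp Real.tendsto_sqrt_atTop).smul_const u
    rw [zero_smul] at h0
    exact (hφ.tendsto 0).comp h0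

end Gauss

/-- The product of finitely many absolutely convergent series, as a series over multi-indices. -/
lemma hasSum_prod_pi {n : ℕ} {f : Fin n → ℕ → ℂ} (hf : ∀ j, Summable fun m => ‖f j m‖) :
    (Summable fun k : Fin n → ℕ => ‖∏ j, f j (k j)‖) ∧
      HasSum (fun k : Fin n → ℕ => ∏ j, f j (k j)) (∏ j, ∑' m, f j m) := by
  induction n with
  | zero => exact ⟨(hasSum_fintype _).summable, by simp⟩
  | succ n ih =>
    obtain ⟨h1, h2⟩ := ih (f := fun j => f j.succ) fun j => hf j.succ
    set g : (Fin n → ℕ) → ℂ := fun k => ∏ j : Fin n, f j.succ (k j) with hg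
    have hs : Summable fun x : ℕ × (Fin n → ℕ) => ‖f 0 x.1 * g x.2‖ :=
      Summable.mul_norm (f := f 0) (g := g) (hf 0) h1
    have h0 : HasSum (f 0) (∑' m, f 0 m) := (Summable.of_norm (hf 0)).hasSum
    have hm : HasSum (fun x : ℕ × (Fin n → ℕ) => f 0 x.1 * g x.2)
        ((∑' m, f 0 m) * ∏ j : Fin n, ∑' m, f j.succ m) :=
      HasSum.mul (f := f 0) (g := g) h0 h2 (Summable.of_norm hs)
    rw [← (Fin.consEquiv fun _ : Fin (n + 1) => ℕ).summable_iff,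
      ← (Fin.consEquiv fun _ : Fin (n + 1) => ℕ).hasSum_iff]
    simp only [Function.comp_def, Fin.prod_univ_succ, Fin.consEquiv_apply, Fin.cons_zero,
      Fin.cons_succ]
    exact ⟨hs, hm⟩

lemma summable_pow_sum {n : ℕ} {q : ℝ} (hq0 : 0 ≤ q) (hq : q < 1) :
    Summable fun k : Fin n → ℕ => q ^ ∑ j, k j := by
  have h := (hasSum_prod_pi (n := n) (f := fun _ m => (q : ℂ) ^ m) fun j => by
    simpa [abs_of_nonneg hq0] using summable_geometric_of_lt_one hq0 hq).1
  simpa [Finset.prod_pow_eq_pow_sum, abs_of_nonneg hq0] using h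

/-! ### Bounds for the Laguerre kernels -/

section Kernel

variable {n r : ℕ} {B : Horiz n →L[ℝ] Horiz n →L[ℝ] Center r}

namespace NormalizingFrame

variable (F : NormalizingFrame B)

/-- The numbers `μ_j(τ)`, in the form `|τ| μ_j(τ / |τ|)`. -/
noncomputable def scaledMu (τ : Center r) (j : Fin n) : ℝ := ‖τ‖ * F.mu (dir τ) j

lemma scaledMu_eq (τ : Center r) (j : Fin n) : F.scaledMu τ j = muOf B F.basis τ j := by
  rcases eq_or_ne τ 0 with rfl | hτ
  · simp [scaledMu, muOf, formAt]
  · have hb : F.basis (dir τ) = F.basis τ := by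
      rw [dir, F.basis_smul _ _ (inv_pos.2 (norm_pos_iff.2 hτ))]
    rw [scaledMu, mu, muOf, muOf, hb, formAt_eq_norm_mul B τ, mul_neg]

/-- Non-degeneracy makes the `μ_j` positive: otherwise `v_{2j-1}^τ` is in the kernel of `B^τ`. -/
lemma ae_scaledMu_pos (hnd : ∀ᵐ τ : Center r, NondegenerateAt B τ) :
    ∀ᵐ τ : Center r, ∀ j, 0 < F.scaledMu τ j := by
  filter_upwards [hnd, F.normalizes] with τ hτ hF j
  rw [scaledMu_eq]
  refine lt_of_le_of_ne (hF.1 j) fun h0 => ?_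
  have hz : F.basis τ (j, 0) = 0 := hτ _ fun y => by
    rw [hF.2]
    refine Finset.sum_eq_zero fun l _ => ?_
    rcases eq_or_ne l j with rfl | hl
    · rw [← h0, zero_mul]
    · simp [OrthonormalBasis.repr_self, hl]
  have := (F.basis τ).orthonormal.1 (j, 0)
  rw [hz, norm_zero] at this
  exact zero_ne_one this

lemma mu_dir_pos {τ : Center r} {j : Fin n} (h : 0 < F.scaledMu τ j) : 0 < F.mu (dir τ) j :=
  pos_of_mul_pos_right h (norm_nonneg _)

lemma norm_sqrt_mu_mul_coord_sq {τ : Center r} {j : Fin n} (h : 0 ≤ F.mu (dir τ) j)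
    (y : Horiz n) : ‖(√(F.mu (dir τ) j) : ℂ) * F.coord τ y j‖ ^ 2 =
      F.mu (dir τ) j * ((F.basis τ).repr y (j, 0) ^ 2 + (F.basis τ).repr y (j, 1) ^ 2) := by
  rw [norm_mul, mul_pow, Complex.norm_real, Real.norm_eq_abs, sq_abs, Real.sq_sqrt h, coord,
    mul_comm Complex.I, Complex.sq_norm, Complex.normSq_add_mul_I]

/-- The Laguerre kernel is dominated by a Gaussian whose integral does not depend on `τ`. -/
lemma exists_norm_laguerreFourier_le (k : Fin n → ℕ) (p : Fin n → ℤ) : ∃ C : ℝ, 0 ≤ C ∧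
    ∀ τ : Center r, (∀ j, 0 < F.scaledMu τ j) → ∀ y,
      ‖F.laguerreFourier k p (y, τ)‖ ≤
        C * planeGaussian (F.basis τ) (fun j => F.scaledMu τ j / 2) y := by
  choose C hC h using fun j => exists_abs_laguerreFun_le_mul_exp (k j) (p j).natAbs
  refine ⟨∏ j, 4 * C j, Finset.prod_nonneg fun j _ => mul_nonneg zero_le_four (hC j),
    fun τ hτ y => ?_⟩
  rw [laguerreFourier, norm_prod, planeGaussian, ← Finset.prod_mul_distrib]
  refine Finset.prod_le_prod (fun _ _ => norm_nonneg _) fun j _ => ?_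
  have hμ : 0 < F.mu (dir τ) j := F.mu_dir_pos (hτ j)
  have h1 := norm_planeLaguerre (k j) (p j)
    ((√(F.mu (dir τ) j) : ℂ) * F.coord τ y j) (norm_nonneg τ)
  rw [F.norm_sqrt_mu_mul_coord_sq hμ.le] at h1
  set S := (F.basis τ).repr y (j, 0) ^ 2 + (F.basis τ).repr y (j, 1) ^ 2 with hS
  have hS0 : 0 ≤ S := by positivity
  have h2 := h j (2 * ‖τ‖ * (F.mu (dir τ) j * S)) (by positivity)
  rw [norm_mul, Complex.norm_real, Real.norm_of_nonneg hμ.le]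
  calc F.mu (dir τ) j * ‖planeLaguerre (k j) (p j) ((√(F.mu (dir τ) j) : ℂ) * F.coord τ y j) ‖τ‖‖
      ≤ F.mu (dir τ) j * (2 * ‖τ‖ / Real.pi *
          (C j * Real.exp (-(2 * ‖τ‖ * (F.mu (dir τ) j * S)) / 4))) := by
        gcongr
        exact h1.trans (mul_le_mul_of_nonneg_left h2 (by positivity))
    _ = _ := by
        rw [scaledMu, show -(2 * ‖τ‖ * (F.mu (dir τ) j * S)) / 4 =
          -(‖τ‖ * F.mu (dir τ) j / 2 * S) by ring]
        ring

/-- Uniform subexponential growth in `k` of the Laguerre kernels with `p = 0`. -/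
lemma exists_norm_laguerreFourier_zero_mul_pow_le {ρ : ℝ} (hρ : 0 < ρ) (hρ1 : ρ < 1) :
    ∃ M : ℝ, 0 ≤ M ∧ ∀ (k : Fin n → ℕ) (z : Horiz n × Center r),
      ‖F.laguerreFourier k 0 z‖ * ρ ^ (∑ j, k j) ≤ M * (1 + ‖z‖) ^ n := by
  have hρ' : 0 < 1 - ρ := sub_pos.2 hρ1
  refine ⟨(‖B‖ * (2 / Real.pi * (1 - ρ)⁻¹)) ^ n, by positivity, fun k z => ?_⟩
  have hn : (‖B‖ * (2 / Real.pi * (1 - ρ)⁻¹)) ^ n * (1 + ‖z‖) ^ n =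
      ∏ _j : Fin n, (‖B‖ * (2 / Real.pi * (1 - ρ)⁻¹) * (1 + ‖z‖)) := by simp [mul_pow]
  rw [laguerreFourier, norm_prod, ← Finset.prod_pow_eq_pow_sum, ← Finset.prod_mul_distrib, hn]
  refine Finset.prod_le_prod (fun _ _ => by positivity) fun j _ => ?_
  rw [norm_mul, Complex.norm_real, Real.norm_eq_abs, mul_assoc]
  have h1 : |F.mu (dir z.2) j| ≤ ‖B‖ :=
    (F.abs_mu_le _ j).trans (mul_le_of_le_one_left (norm_nonneg B) (norm_dir_le _))
  have h2 : ‖z.2‖ ≤ 1 + ‖z‖ := (norm_snd_le z).trans (by linarith)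
  have h3 := norm_planeLaguerre_zero_mul_pow_le (k j)
    ((√(F.mu (dir z.2) j) : ℂ) * F.coord z.2 z.1 j) (norm_nonneg z.2) hρ hρ1
  rw [mul_assoc ‖B‖]
  refine mul_le_mul h1 (h3.trans ?_) (by positivity) (norm_nonneg B)
  calc 2 * ‖z.2‖ / Real.pi * (1 - ρ)⁻¹ = 2 / Real.pi * (1 - ρ)⁻¹ * ‖z.2‖ := by ring
    _ ≤ _ := by gcongr

/-- The partial Fourier transform `∑_k R^{|k|} 𝓛̃_k^{(0)}` of the kernel of the Abel means. -/
noncomputable def abelKernel (R : ℝ) (z : Horiz n × Center r) : ℂ :=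
  ∑' k : Fin n → ℕ, F.laguerreFourier k 0 z * (R : ℂ) ^ (∑ j, k j)

variable {R : ℝ}

/-- The multi-index series factors over the planes, and each factor is summed by the generating
function. -/
lemma hasSum_abelKernel (hR0 : 0 ≤ R) (hR : R < 1) (z : Horiz n × Center r) :
    HasSum (fun k : Fin n → ℕ => F.laguerreFourier k 0 z * (R : ℂ) ^ (∑ j, k j))
      (F.abelKernel R z) ∧
    F.abelKernel R z = ((∏ j, F.mu (dir z.2) j * (2 * ‖z.2‖ / Real.pi * ((1 - R)⁻¹ *
      Real.exp (-((1 + R) / (1 - R) *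
        (‖z.2‖ * ‖(√(F.mu (dir z.2) j) : ℂ) * F.coord z.2 z.1 j‖ ^ 2))))) : ℝ) : ℂ) := by
  have hj : ∀ j, HasSum (fun m : ℕ => (F.mu (dir z.2) j : ℂ) * (planeLaguerre m 0
      ((√(F.mu (dir z.2) j) : ℂ) * F.coord z.2 z.1 j) ‖z.2‖ * (R : ℂ) ^ m)) _ := fun j =>
    (hasSum_planeLaguerre_zero _ _ hR0 hR).mul_left _
  set P := ∏ j, (F.mu (dir z.2) j : ℂ) * ((2 * ‖z.2‖ / Real.pi * ((1 - R)⁻¹ *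
      Real.exp (-((1 + R) / (1 - R) *
        (‖z.2‖ * ‖(√(F.mu (dir z.2) j) : ℂ) * F.coord z.2 z.1 j‖ ^ 2)))) : ℝ) : ℂ) with hP
  have h := (hasSum_prod_pi fun j => (hj j).summable.norm).2
  simp only [(hj _).tsum_eq] at h
  have h' : HasSum (fun k : Fin n → ℕ => F.laguerreFourier k 0 z * (R : ℂ) ^ (∑ j, k j)) P := by
    refine h.congr_fun fun k => ?_
    rw [laguerreFourier, ← Finset.prod_pow_eq_pow_sum, ← Finset.prod_mul_distrib]
    refine Finset.prod_congr rfl fun j _ => ?_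
    rw [Pi.zero_apply, mul_assoc]
  have he : F.abelKernel R z = P := h'.tsum_eq
  refine ⟨he ▸ h', he.trans ?_⟩
  rw [hP]
  push_cast
  rfl

/-- The Abel kernel is, up to a constant tending to one as `R → 1`, a Gaussian density. -/
lemma abelKernel_eq_planeGaussian (hR0 : 0 ≤ R) (hR : R < 1) {τ : Center r}
    (h : ∀ j, 0 < F.scaledMu τ j) (y : Horiz n) :
    F.abelKernel R (y, τ) = (((2 / (1 + R)) ^ n * planeGaussian (F.basis τ)
      (fun j => (1 + R) / (1 - R) * F.scaledMu τ j) y : ℝ) : ℂ) := by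
  have hn : (2 / (1 + R)) ^ n = ∏ _j : Fin n, (2 / (1 + R)) := by
    rw [Finset.prod_const, Finset.card_univ, Fintype.card_fin]
  rw [(F.hasSum_abelKernel hR0 hR _).2, planeGaussian, hn, ← Finset.prod_mul_distrib]
  congr 1
  refine Finset.prod_congr rfl fun j _ => ?_
  have h1 : 1 - R ≠ 0 := by linarith
  have h2 : 1 + R ≠ 0 := by linarith
  rw [F.norm_sqrt_mu_mul_coord_sq (F.mu_dir_pos (h j)).le, scaledMu]
  simp only
  rw [mul_assoc ((1 + R) / (1 - R)) (‖τ‖ * _), mul_assoc ‖τ‖]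
  field_simp

lemma norm_abelKernel_le (hR0 : 0 ≤ R) (hR : R < 1) (z : Horiz n × Center r) :
    ‖F.abelKernel R z‖ ≤ (‖B‖ * (2 / Real.pi * (1 - R)⁻¹)) ^ n * (1 + ‖z‖) ^ n := by
  have hR' : 0 < 1 - R := sub_pos.2 hR
  have hn : (‖B‖ * (2 / Real.pi * (1 - R)⁻¹)) ^ n * (1 + ‖z‖) ^ n =
      ∏ _j : Fin n, (‖B‖ * (2 / Real.pi * (1 - R)⁻¹ * (1 + ‖z‖))) := by simp [mul_pow, mul_assoc]
  rw [(F.hasSum_abelKernel hR0 hR z).2, Complex.norm_real, norm_prod, hn]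
  refine Finset.prod_le_prod (fun _ _ => norm_nonneg _) fun j _ => ?_
  have h1 : |F.mu (dir z.2) j| ≤ ‖B‖ :=
    (F.abs_mu_le _ j).trans (mul_le_of_le_one_left (norm_nonneg B) (norm_dir_le _))
  have h2 : ‖z.2‖ ≤ 1 + ‖z‖ := (norm_snd_le z).trans (by linarith)
  rw [norm_mul, Real.norm_eq_abs]
  refine mul_le_mul h1 ?_ (norm_nonneg _) (norm_nonneg B)
  rw [Real.norm_of_nonneg (by positivity)]
  calc 2 * ‖z.2‖ / Real.pi * ((1 - R)⁻¹ * Real.exp (-((1 + R) / (1 - R) *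
        (‖z.2‖ * ‖(√(F.mu (dir z.2) j) : ℂ) * F.coord z.2 z.1 j‖ ^ 2))))
      ≤ 2 * (1 + ‖z‖) / Real.pi * ((1 - R)⁻¹ * 1) := by
        gcongr
        exact Real.exp_le_one_iff.2 (neg_nonpos.2 (by positivity))
    _ = _ := by ring

lemma aestronglyMeasurable_abelKernel (hR0 : 0 ≤ R) (hR : R < 1) :
    AEStronglyMeasurable (F.abelKernel R) volume := by
  refine aestronglyMeasurable_of_tendsto_ae (u := (atTop : Filter (Finset (Fin n → ℕ))))
    (f := fun s z => ∑ k ∈ s, F.laguerreFourier k 0 z * (R : ℂ) ^ (∑ j, k j)) (fun s => ?_)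
    (Eventually.of_forall fun z => (F.hasSum_abelKernel hR0 hR z).1)
  exact Finset.aestronglyMeasurable_fun_sum _ fun k _ =>
    (F.aestronglyMeasurable_laguerreFourier k 0).mul_const _

end NormalizingFrame

/-! ### Boundedness on `L²` -/

lemma quasiMeasurePreserving_smul_center {c : ℝ} (hc : c ≠ 0) :
    Measure.QuasiMeasurePreserving (fun ξ : Center r => c • ξ) := by
  refine ⟨by fun_prop, ?_⟩
  rw [Measure.map_addHaar_smul _ hc]
  exact Measure.smul_absolutelyContinuous

lemma aestronglyMeasurable_comp_smul_center {g : Horiz n × Center r → ℂ}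
    (hg : AEStronglyMeasurable g volume) {c : ℝ} (hc : c ≠ 0) :
    AEStronglyMeasurable (fun z : Horiz n × Center r => g (z.1, c • z.2)) volume := by
  refine hg.comp_quasiMeasurePreserving (f := fun z : Horiz n × Center r => (z.1, c • z.2)) ?_
  rw [Measure.volume_eq_prod]
  exact QuasiMeasurePreserving.prodMap (Measure.QuasiMeasurePreserving.id _)
    (quasiMeasurePreserving_smul_center hc)

variable (F : NormalizingFrame B)

lemma convDistribution_eq_fourierInv (f : 𝓢(Horiz n × Center r, ℂ)) (k : Fin n → ℕ)
    (p : Fin n → ℤ) (w : Horiz n × Center r) :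
    convDistribution B f (F.laguerreDistribution k p) w =
      𝓕⁻ (twistedConv B (fun z => F.laguerreFourier k p (z.1, (2 * Real.pi) • z.2)) f w.1) w.2 := by
  rw [convDistribution, F.laguerreDistribution_apply]
  exact integral_mul_invPartialFourier_translateInv B
    (F.aestronglyMeasurable_laguerreFourier k p) (F.exists_laguerreFourier_le k p) f w

/-- The Laguerre kernels are in `L¹` of the fibres, uniformly in the frequency. -/
lemma exists_lintegral_laguerreFourier_le (hnd : ∀ᵐ τ : Center r, NondegenerateAt B τ)
    (k : Fin n → ℕ) (p : Fin n → ℤ) : ∃ C : ℝ, 0 ≤ C ∧ ∀ᵐ τ : Center r,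
      ∫⁻ y, ‖F.laguerreFourier k p (y, τ)‖ₑ ≤ ENNReal.ofReal C := by
  obtain ⟨C, hC, h⟩ := F.exists_norm_laguerreFourier_le k p
  refine ⟨C, hC, ?_⟩
  filter_upwards [F.ae_scaledMu_pos hnd] with τ hτ
  refine le_trans (lintegral_mono fun y => ?_)
    (lintegral_ofReal_mul_planeGaussian (e := F.basis τ)
      (lam := fun j => F.scaledMu τ j / 2) (fun j => half_pos (hτ j)) hC).le
  rw [← ofReal_norm]
  exact ENNReal.ofReal_le_ofReal (h τ hτ y)

lemma exists_eLpNorm_convDistribution_le (hnd : ∀ᵐ τ : Center r, NondegenerateAt B τ)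
    (k : Fin n → ℕ) (p : Fin n → ℤ) : ∃ C : ℝ, 0 ≤ C ∧ ∀ f : 𝓢(Horiz n × Center r, ℂ),
      MemLp (convDistribution B f (F.laguerreDistribution k p)) 2 volume ∧
      eLpNorm (convDistribution B f (F.laguerreDistribution k p)) 2 volume ≤
        ENNReal.ofReal C * eLpNorm f 2 volume := by
  have hπ : (2 * Real.pi) ≠ 0 := by positivity
  obtain ⟨C, hC, h⟩ := exists_lintegral_laguerreFourier_le F hnd k p
  refine ⟨C, hC, fun f => ?_⟩
  have hk := (quasiMeasurePreserving_smul_center (r := r) hπ).ae h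
  have hKm := aestronglyMeasurable_comp_smul_center
    (F.aestronglyMeasurable_laguerreFourier k p) hπ
  have hfun : (fun w : Horiz n × Center r => 𝓕⁻ (twistedConv B
      (fun z => F.laguerreFourier k p (z.1, (2 * Real.pi) • z.2)) f w.1) w.2) =
      convDistribution B f (F.laguerreDistribution k p) :=
    funext fun w => (convDistribution_eq_fourierInv F f k p w).symm
  obtain ⟨hm, hle⟩ := lintegral_enorm_sq_fourierInv_twistedConv_le (B := B) hKm hC hk f
  rw [hfun] at hm
  have hle' : eLpNorm (fun w : Horiz n × Center r => 𝓕⁻ (twistedConv B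
      (fun z => F.laguerreFourier k p (z.1, (2 * Real.pi) • z.2)) f w.1) w.2) 2 volume ≤
      ENNReal.ofReal C * eLpNorm f 2 volume := eLpNorm_two_le_of_lintegral_sq_le hle
  rw [hfun] at hle'
  have hf : eLpNorm f 2 volume < ⊤ := (f.memLp 2 volume).2
  exact ⟨⟨hm, hle'.trans_lt (ENNReal.mul_lt_top ENNReal.ofReal_lt_top hf)⟩, hle'⟩

lemma convDistribution_add (f g : 𝓢(Horiz n × Center r, ℂ)) (u : 𝓢'(Horiz n × Center r, ℂ)) :
    convDistribution B (f + g) u = convDistribution B f u + convDistribution B g u := by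
  funext w
  have : translateInv B (f + g) w = translateInv B f w + translateInv B g w := by
    ext v; simp
  simp only [convDistribution, this, map_add, Pi.add_apply]

lemma convDistribution_smul (c : ℂ) (f : 𝓢(Horiz n × Center r, ℂ))
    (u : 𝓢'(Horiz n × Center r, ℂ)) :
    convDistribution B (c • f) u = c • convDistribution B f u := by
  funext w
  have : translateInv B (c • f) w = c • translateInv B f w := by
    ext v; simp
  simp only [convDistribution, this, map_smul, Pi.smul_apply]

/-- An operator on Schwartz functions that is bounded for the `L²` norm extends uniquely to `L²`. -/
theorem existsUnique_convDistribution_extension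
    (hnd : ∀ᵐ τ : Center r, NondegenerateAt B τ) (k : Fin n → ℕ) (p : Fin n → ℤ) :
    ∃! T : Lp ℂ 2 (volume : Measure (Horiz n × Center r)) →L[ℂ]
        Lp ℂ 2 (volume : Measure (Horiz n × Center r)),
      ∀ f : 𝓢(Horiz n × Center r, ℂ), T (f.toLp 2 volume) =ᵐ[volume]
        convDistribution B f (F.laguerreDistribution k p) := by
  obtain ⟨C, hC, h⟩ := exists_eLpNorm_convDistribution_le F hnd k p
  set e : 𝓢(Horiz n × Center r, ℂ) →ₗ[ℂ] Lp ℂ 2 (volume : Measure (Horiz n × Center r)) :=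
    (SchwartzMap.toLpCLM ℂ ℂ 2 volume).toLinearMap with he
  have hdense : DenseRange e :=
    SchwartzMap.denseRange_toLpCLM (F := ℂ) (μ := (volume : Measure (Horiz n × Center r))) (p := 2)
      ENNReal.ofNat_ne_top
  let S : 𝓢(Horiz n × Center r, ℂ) →ₗ[ℂ] Lp ℂ 2 (volume : Measure (Horiz n × Center r)) :=
    { toFun := fun f => (h f).1.toLp
      map_add' := fun f g => by
        rw [← MemLp.toLp_add]
        exact MemLp.toLp_congr _ _ (by rw [convDistribution_add])
      map_smul' := fun c f => by
        rw [RingHom.id_apply, ← MemLp.toLp_const_smul]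
        exact MemLp.toLp_congr _ _ (by rw [convDistribution_smul]) }
  have hS : ∀ f, ‖S f‖ ≤ C * ‖e f‖ := by
    intro f
    have hSf : S f = (h f).1.toLp := rfl
    have hef : e f = f.toLp 2 volume := rfl
    have h1 : ‖S f‖ₑ ≤ ENNReal.ofReal C * ‖e f‖ₑ := by
      rw [hSf, hef, Lp.enorm_def, Lp.enorm_def, eLpNorm_congr_ae (h f).1.coeFn_toLp,
        eLpNorm_congr_ae (f.coeFn_toLp 2 volume)]
      exact (h f).2
    rwa [← ofReal_norm, ← ofReal_norm, ← ENNReal.ofReal_mul hC, ENNReal.ofReal_le_ofReal_iff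
      (by positivity)] at h1
  have hT := LinearMap.extendOfNorm_eq (f := S) (e := e) hdense ⟨C, hS⟩
  refine ⟨S.extendOfNorm e, fun f => ?_, fun T' hT' => ?_⟩
  · have := hT f
    change S.extendOfNorm e (f.toLp 2 volume) = S f at this
    rw [this]
    exact (h f).1.coeFn_toLp
  · refine ContinuousLinearMap.coeFn_injective (hdense.equalizer T'.continuous
      (S.extendOfNorm e).continuous (funext fun f => ?_))
    simp only [Function.comp]
    rw [hT f]
    exact Lp.ext ((hT' f).trans (h f).1.coeFn_toLp.symm)

/-! ### Abel summation -/

variable {R : ℝ}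

lemma hasSum_convDistribution (hR0 : 0 ≤ R) (hR : R < 1) (f : 𝓢(Horiz n × Center r, ℂ))
    (w : Horiz n × Center r) :
    HasSum (fun k : Fin n → ℕ =>
      convDistribution B f (F.laguerreDistribution k 0) w * (R : ℂ) ^ (∑ j, k j))
      (∫ z, F.abelKernel R z * invPartialFourier (translateInv B f w) z) := by
  -- any `ρ` strictly between `R` and `1` makes the growth `ρ^{-|k|}` summable against `R^{|k|}`
  set ρ := (1 + R) / 2 with hρd
  have hρ : 0 < ρ := by positivity
  have hρ1 : ρ < 1 := by rw [hρd]; linarith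
  have hq : R / ρ < 1 := by rw [div_lt_one hρ, hρd]; linarith
  have hq0 : 0 ≤ R / ρ := by positivity
  obtain ⟨M, hM, hle⟩ := F.exists_norm_laguerreFourier_zero_mul_pow_le hρ hρ1
  set I : Horiz n × Center r → ℂ := invPartialFourier (translateInv B f w) with hI
  have hint : Integrable fun z => ((1 + ‖z‖) ^ n : ℝ) * ‖I z‖ := by
    have := (integrable_mul_invPartialFourier (volume : Measure (Horiz n × Center r))
      (g := fun z => (((1 + ‖z‖) ^ n : ℝ) : ℂ)) (Continuous.aestronglyMeasurable (by fun_prop))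
      ⟨1, n, fun z => by
        rw [Complex.norm_real, Real.norm_of_nonneg (by positivity), one_mul]⟩
      (translateInv B f w)).norm
    refine this.congr (Eventually.of_forall fun z => ?_)
    simp only [norm_mul, Complex.norm_real]
    rw [Real.norm_of_nonneg (by positivity)]
  set G : (Fin n → ℕ) → Horiz n × Center r → ℂ := fun k z =>
    F.laguerreFourier k 0 z * I z * (R : ℂ) ^ (∑ j, k j) with hG
  have hGi : ∀ k, Integrable (G k) := fun k =>
    (integrable_mul_invPartialFourier volume (F.aestronglyMeasurable_laguerreFourier k 0)
      (F.exists_laguerreFourier_le k 0) (translateInv B f w)).mul_const _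
  have hGle : ∀ k z, ‖G k z‖ ≤ (R / ρ) ^ (∑ j, k j) * (M * ((1 + ‖z‖) ^ n * ‖I z‖)) := by
    intro k z
    rw [hG]
    simp only [norm_mul, norm_pow, Complex.norm_real, Real.norm_of_nonneg hR0]
    have hR' : R ^ (∑ j, k j) = (R / ρ) ^ (∑ j, k j) * ρ ^ (∑ j, k j) := by
      rw [← mul_pow, div_mul_cancel₀ _ hρ.ne']
    calc ‖F.laguerreFourier k 0 z‖ * ‖I z‖ * R ^ (∑ j, k j)
        = (R / ρ) ^ (∑ j, k j) * ((‖F.laguerreFourier k 0 z‖ * ρ ^ (∑ j, k j)) * ‖I z‖) := by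
          rw [hR']; ring
      _ ≤ (R / ρ) ^ (∑ j, k j) * ((M * (1 + ‖z‖) ^ n) * ‖I z‖) := by
          refine mul_le_mul_of_nonneg_left ?_ (pow_nonneg hq0 _)
          exact mul_le_mul_of_nonneg_right (hle k z) (norm_nonneg _)
      _ = _ := by ring
  have hsum : Summable fun k => ∫ z, ‖G k z‖ := by
    refine Summable.of_nonneg_of_le (fun k => integral_nonneg fun z => norm_nonneg _) (fun k => ?_)
      ((summable_pow_sum hq0 hq).mul_right (M * ∫ z, (1 + ‖z‖) ^ n * ‖I z‖))
    refine (integral_mono (hGi k).norm ((hint.const_mul M).const_mul _) (hGle k)).trans_eq ?_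
    rw [integral_const_mul, integral_const_mul]
  have h := hasSum_integral_of_summable_integral_norm hGi hsum
  have e1 : ∀ k, ∫ z, G k z =
      convDistribution B f (F.laguerreDistribution k 0) w * (R : ℂ) ^ (∑ j, k j) := fun k => by
    rw [convDistribution, F.laguerreDistribution_apply, integral_mul_const]
  have e2 : ∀ z, ∑' k, G k z = F.abelKernel R z * I z := fun z => by
    refine HasSum.tsum_eq ?_
    refine ((F.hasSum_abelKernel hR0 hR z).1.mul_right (I z)).congr_fun fun k => ?_
    rw [hG]
    ring
  simp only [e1, e2] at h
  exact h

lemma tendsto_two_div_one_add_pow (n : ℕ) :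
    Tendsto (fun R : ℝ => (((2 / (1 + R)) ^ n : ℝ) : ℂ)) (𝓝[<] 1) (𝓝 1) := by
  have h : ContinuousAt (fun R : ℝ => (2 / (1 + R)) ^ n) 1 :=
    (continuousAt_const.div (by fun_prop) (by norm_num)).pow n
  have h1 : Tendsto (fun R : ℝ => (2 / (1 + R)) ^ n) (𝓝[<] 1) (𝓝 1) := by
    have := h.tendsto.mono_left (nhdsWithin_le_nhds (s := Set.Iio 1))
    norm_num at this
    exact this
  exact (Complex.continuous_ofReal.tendsto' 1 1 Complex.ofReal_one).comp h1

lemma tendsto_one_add_div_one_sub :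
    Tendsto (fun R : ℝ => (1 + R) / (1 - R)) (𝓝[<] 1) atTop := by
  have h1 : Tendsto (fun R : ℝ => 1 + R) (𝓝[<] 1) (𝓝 (1 + 1)) :=
    ((continuous_const.add continuous_id).tendsto 1).mono_left nhdsWithin_le_nhds
  have h2 : Tendsto (fun R : ℝ => 1 - R) (𝓝[<] 1) (𝓝[>] 0) := by
    refine tendsto_nhdsWithin_iff.2 ⟨?_, ?_⟩
    · have h : Continuous fun R : ℝ => 1 - R := by fun_prop
      exact (h.tendsto' 1 0 (sub_self 1)).mono_left nhdsWithin_le_nhds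
    · filter_upwards [self_mem_nhdsWithin] with R hR
      exact sub_pos.2 (Set.mem_Iio.1 hR)
  simp only [div_eq_mul_inv]
  exact h1.pos_mul_atTop (by norm_num) (tendsto_inv_nhdsGT_zero.comp h2)

/-- For almost every frequency, the twisted convolution with the Abel kernel converges to `f̃`. -/
lemma tendsto_twistedConv_abelKernel (f : 𝓢(Horiz n × Center r, ℂ)) (x : Horiz n) {ξ : Center r}
    (hξ : ∀ j, 0 < F.scaledMu ((2 * Real.pi) • ξ) j) :
    Tendsto (fun R : ℝ =>
      twistedConv B (fun z => F.abelKernel R (z.1, (2 * Real.pi) • z.2)) f x ξ) (𝓝[<] 1)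
      (𝓝 (𝓕 (slice f x : Center r → ℂ) ξ)) := by
  set φ : Horiz n → ℂ := fun y =>
    Complex.exp (Complex.I * (-(4 * Real.pi * inner ℝ ξ (B x y)) : ℝ)) *
      𝓕 (slice f (x - y) : Center r → ℂ) ξ with hφd
  have hφ : Continuous φ := by
    have h1 : Continuous fun y : Horiz n =>
        Complex.exp (Complex.I * (-(4 * Real.pi * inner ℝ ξ (B x y)) : ℝ)) := by fun_prop
    exact h1.mul (continuous_fourier_slice_sub f x ξ)
  obtain ⟨D, -, -, hD⟩ := exists_fourier_slice_le f
  have hφD : ∀ y, ‖φ y‖ ≤ D ξ := fun y => by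
    rw [hφd]
    simp only
    rw [norm_mul, mul_comm Complex.I, Complex.norm_exp_ofReal_mul_I, one_mul]
    exact hD _ _
  have hG := (tendsto_integral_planeGaussian_mul (e := F.basis ((2 * Real.pi) • ξ))
    (lam := F.scaledMu ((2 * Real.pi) • ξ)) hξ hφ hφD).comp tendsto_one_add_div_one_sub
  have h := (tendsto_two_div_one_add_pow n).mul hG
  have h0 : φ 0 = 𝓕 (slice f x : Center r → ℂ) ξ := by simp [hφd]
  rw [one_mul, h0] at h
  refine h.congr' ?_
  filter_upwards [self_mem_nhdsWithin, mem_nhdsWithin_of_mem_nhds (lt_mem_nhds zero_lt_one)]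
    with R hR hR0
  simp only [twistedConv, Function.comp, F.abelKernel_eq_planeGaussian hR0.le hR hξ]
  rw [← integral_const_mul]
  refine integral_congr_ae (Eventually.of_forall fun y => ?_)
  simp only [hφd]
  push_cast
  ring

/-- The Abel means converge pointwise: dominated convergence in the frequency variable, followed by
Fourier inversion in the center. -/
theorem tendsto_integral_abelKernel (hnd : ∀ᵐ τ : Center r, NondegenerateAt B τ)
    (f : 𝓢(Horiz n × Center r, ℂ)) (w : Horiz n × Center r) :
    Tendsto (fun R : ℝ => ∫ z, F.abelKernel R z * invPartialFourier (translateInv B f w) z)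
      (𝓝[<] 1) (𝓝 (f w)) := by
  have hπ : (2 * Real.pi) ≠ 0 := by positivity
  set Φ : ℝ → Center r → ℂ := fun R =>
    twistedConv B (fun z => F.abelKernel R (z.1, (2 * Real.pi) • z.2)) f w.1 with hΦ
  have hev : ∀ᶠ R : ℝ in 𝓝[<] 1, 0 ≤ R ∧ R < 1 := by
    filter_upwards [self_mem_nhdsWithin, mem_nhdsWithin_of_mem_nhds (lt_mem_nhds zero_lt_one)]
      with R hR hR0 using ⟨le_of_lt hR0, hR⟩
  have heq : ∀ᶠ R : ℝ in 𝓝[<] 1, 𝓕⁻ (Φ R) w.2 =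
      ∫ z, F.abelKernel R z * invPartialFourier (translateInv B f w) z := by
    filter_upwards [hev] with R hR
    exact (integral_mul_invPartialFourier_translateInv B
      (F.aestronglyMeasurable_abelKernel hR.1 hR.2) ⟨_, n, F.norm_abelKernel_le hR.1 hR.2⟩ f w).symm
  refine Tendsto.congr' heq ?_
  have hinv : 𝓕⁻ (𝓕 (slice f w.1 : Center r → ℂ)) w.2 = f w := by
    rw [← SchwartzMap.fourier_coe, ← SchwartzMap.fourierInv_coe,
      FourierTransform.fourierInv_fourier_eq]
    rfl
  rw [← hinv]
  simp only [Real.fourierInv_eq']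
  have hpos := (quasiMeasurePreserving_smul_center hπ).ae (F.ae_scaledMu_pos hnd)
  obtain ⟨D, hDi, -, hD⟩ := exists_fourier_slice_le f
  refine tendsto_integral_filter_of_dominated_convergence (fun ξ => 2 ^ n * D ξ) ?_ ?_
    (hDi.const_mul _) ?_
  · filter_upwards [hev] with R hR
    have hc : Continuous fun ξ : Center r =>
        Complex.exp ((2 * Real.pi * inner ℝ ξ w.2 : ℝ) * Complex.I) := by fun_prop
    refine hc.aestronglyMeasurable.smul ?_
    exact aestronglyMeasurable_twistedConv (aestronglyMeasurable_comp_smul_center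
      (F.aestronglyMeasurable_abelKernel hR.1 hR.2) hπ) f w.1
  · filter_upwards [hev] with R hR
    filter_upwards [hpos] with ξ hξ
    rw [norm_smul, Complex.norm_exp_ofReal_mul_I, one_mul]
    refine norm_twistedConv_le (by positivity) ?_ (fun y => hD y ξ) _
    have hR2 : (2 / (1 + R)) ^ n ≤ 2 ^ n := by
      have : 0 ≤ R := hR.1
      gcongr
      exact div_le_self zero_le_two (by linarith)
    have ha : 0 < (1 + R) / (1 - R) := div_pos (by linarith [hR.1]) (by linarith [hR.2])
    have hl : ∀ j, 0 < (1 + R) / (1 - R) * F.scaledMu ((2 * Real.pi) • ξ) j := fun j =>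
      mul_pos ha (hξ j)
    refine le_trans (lintegral_mono fun y => ?_)
      (lintegral_ofReal_mul_planeGaussian (e := F.basis ((2 * Real.pi) • ξ)) hl
        (pow_nonneg zero_le_two n)).le
    have hG := planeGaussian_nonneg (e := F.basis ((2 * Real.pi) • ξ)) (fun j => (hl j).le) y
    have hR3 : 0 ≤ (2 / (1 + R)) ^ n := pow_nonneg (div_nonneg zero_le_two (by linarith [hR.1])) n
    rw [F.abelKernel_eq_planeGaussian hR.1 hR.2 hξ, ← ofReal_norm, Complex.norm_real,
      Real.norm_of_nonneg (mul_nonneg hR3 hG)]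
    exact ENNReal.ofReal_le_ofReal (mul_le_mul_of_nonneg_right hR2 hG)
  · filter_upwards [hpos] with ξ hξ
    exact (tendsto_twistedConv_abelKernel F f w.1 hξ).const_smul _

end Kernel

end StepTwo

theorem mainTheorem5 (n r : ℕ)
    (B : StepTwo.Horiz n →L[ℝ] StepTwo.Horiz n →L[ℝ] StepTwo.Center r)
    (hB : ∀ x y, B x y = -B y x)
    (hnd : ∀ᵐ τ : StepTwo.Center r, StepTwo.NondegenerateAt B τ)
    (F : StepTwo.NormalizingFrame B) :
    (∀ (k : Fin n → ℕ) (p : Fin n → ℤ),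
      ∃! T : Lp ℂ 2 (volume : Measure (StepTwo.Horiz n × StepTwo.Center r)) →L[ℂ]
          Lp ℂ 2 (volume : Measure (StepTwo.Horiz n × StepTwo.Center r)),
        ∀ f : 𝓢(StepTwo.Horiz n × StepTwo.Center r, ℂ),
          T (f.toLp 2 volume) =ᵐ[volume]
            StepTwo.convDistribution B f (F.laguerreDistribution k p)) ∧
    ∀ f : 𝓢(StepTwo.Horiz n × StepTwo.Center r, ℂ),
      (∀ R : ℝ, 0 ≤ R → R < 1 → ∀ w, Summable fun k : Fin n → ℕ =>
        StepTwo.convDistribution B f (F.laguerreDistribution k 0) w * (R : ℂ) ^ (∑ j, k j)) ∧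
      ∀ w, Tendsto (fun R : ℝ => ∑' k : Fin n → ℕ,
          StepTwo.convDistribution B f (F.laguerreDistribution k 0) w * (R : ℂ) ^ (∑ j, k j))
        (𝓝[<] 1) (𝓝 (f w)) := by
  refine ⟨fun k p => StepTwo.existsUnique_convDistribution_extension F hnd k p, fun f => ⟨?_, ?_⟩⟩
  · exact fun R hR0 hR w => (StepTwo.hasSum_convDistribution F hR0 hR f w).summable
  · intro w
    refine (StepTwo.tendsto_integral_abelKernel F hnd f w).congr' ?_
    filter_upwards [self_mem_nhdsWithin, mem_nhdsWithin_of_mem_nhds (lt_mem_nhds zero_lt_one)]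
      with R hR hR0
    exact (StepTwo.hasSum_convDistribution F (le_of_lt hR0) hR f w).tsum_eq.symm
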